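/- **Timed words.** A finite timed word over a finite alphabet $\Sigma$ is a sequence $\rho=(\sigma_1,\tau_1)\cdots(\sigma_{n'},\tau_{n'})$ with $\sigma_j\in\Sigma$ and $0\le\tau_1\le\dots\le\tau_{n'}$ real; put $\tau_0=0$. **Automata.** A timed Büchi automaton (TBA) $\mathcal A=(Q,Q_0,\Sigma,C,\Delta,\mathcal F)$ consists of a finite set $Q$ of locations, initial locations $Q_0\subseteq Q$, a finite alphabet $\Sigma$, a finite set $C$ of clocks, a finite set $\Delta\subseteq Q\times Q\times\Sigma\times 2^{C}\times G(C)$ of transitions and accepting locations $\mathcal F\subseteq Q$, where $G(C)$ is the set of clock constraints, i.e. finite conjunctions of atoms $c\sim k$ with $c\in C$, $k\in\mathbb N_0$, ${\sim}\in\{<,\le,=,\ge,>\}$. A run prefix of $\mathcal A$ processing $\rho$ is a sequence $(q_0,v_0),\dots,(q_{n'},v_{n'})$ with $q_j\in Q$, $v_j\colon C\to\mathbb R_{\ge0}$, $q_0\in Q_0$, $v_0\equiv 0$, such that for each $1\le j\le n'$ there is a transition $(q_{j-1},q_j,\sigma_j,\lambda,g)\in\Delta$ for which $v_{j-1}+(\tau_j-\tau_{j-1})$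 satisfies $g$, $v_j(c)=0$ for $c\in\lambda$, and $v_j(c)=v_{j-1}(c)+(\tau_j-\tau_{j-1})$ for $c\in C\setminus\lambda$. **Observations.** A rational $\mathcal A$-observation is a finite sequence $o=(\phi_1,I_1,m_1)\cdots(\phi_n,I_n,m_n)$, $n\ge 0$, where each $\phi_i$ is a propositional formula over the propositions $\Sigma\cup Q\cup G(C)$, each $I_i$ is a bounded interval of $\mathbb R_{\ge0}$ with rational endpoints (each endpoint may or may not belong to $I_i$), and each multiplicity $m_i$ is of the form $\le e$, $=e$ or $\ge e$ with $e\in\mathbb N_0$. For $\sigma\in\Sigma$ and a state $(q,v)$, the relation $\sigma,(q,v)\models\phi$ is defined by: a proposition $\sigma'\in\Sigma$ holds iff $\sigma'=\sigma$, a proposition $q'\in Q$ holds iff $q'=q$, a proposition $g\in G(C)$ holds iff $v$ satisfies $g$, and Boolean connectives are interpreted as usual. **Consistency.** The word $\rho$ is consistent with $o$ if there are a run prefix $(q_0,v_0),\dots,(q_{n'},v_{n'})$ of $\mathcal A$ processing $\rho$ and a non-decreasing map $h\colon\{1,\dots,n'\}\to\{1,\dots,n\}$ such that $\sigma_j,(q_j,v_j)\models\phi_{h(j)}$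 and $\tau_j\in I_{h(j)}$ for all $1\le j\le n'$, and for every $1\le i\le n$ the number $|h^{-1}(i)|$ satisfies the constraint $m_i$. Let $L_{\mathcal A}(o)$ be the set of all finite timed words that are consistent with $o$. **Lemma.** The following problem is decidable: given (a finite description of) a TBA $\mathcal A$ and a rational $\mathcal A$-observation $o$, is $L_{\mathcal A}(o)$ nonempty? That is, there is an algorithm that, on input $\mathcal A$ and $o$, always halts and answers correctly. -/

import Mathlib

open scoped NNReal

namespace TimedMon

/-! ### Finite timed words -/

/-- A finite timed word over `S`: a word together with an equally long, non-decreasing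
sequence of time stamps in `ℝ≥0`. -/
structure TimedWord (S : Type) where
  len : ℕ
  letter : Fin len → S
  time : Fin len → ℝ≥0
  mono : Monotone time

/-- The time stamps `τ₀, τ₁, …, τₙ`, where `τ₀ = 0`. -/
def TimedWord.stamp {S : Type} (w : TimedWord S) : Fin (w.len + 1) → ℝ≥0 :=
  Fin.cons 0 w.time

/-- The delay between two consecutive time stamps. Since the stamps are non-decreasing, the
truncated subtraction of `ℝ≥0` is the real one here. -/
def TimedWord.delay {S : Type} (w : TimedWord S) (i : Fin w.len) : ℝ≥0 :=
  w.stamp i.succ - w.stamp i.castSucc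

/-! ### Clock constraints and timed Büchi automata -/

/-- The comparison symbols `<, ≤, =, ≥, >`. -/
inductive Cmp where
  | lt | le | eq | ge | gt

def Cmp.Holds : Cmp → ℝ≥0 → ℝ≥0 → Prop
  | .lt, x, y => x < y
  | .le, x, y => x ≤ y
  | .eq, x, y => x = y
  | .ge, x, y => x ≥ y
  | .gt, x, y => x > y

/-- An atomic constraint `c ∼ n` with a clock `c` and a natural number `n`. -/
structure AtomicConstraint (C : Type) where
  clock : C
  cmp : Cmp
  bound : ℕ

/-- A clock constraint: a finite conjunction of atomic constraints (the empty one is true). -/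
abbrev ClockConstraint (C : Type) := List (AtomicConstraint C)

/-- The valuation `v` satisfies the clock constraint `g`. -/
def ClockConstraint.Sat {C : Type} (g : ClockConstraint C) (v : C → ℝ≥0) : Prop :=
  ∀ a ∈ g, a.cmp.Holds (v a.clock) (a.bound : ℝ≥0)

/-- A transition `(q, q', a, λ, g)`; the set `λ` of clocks to reset is given by a list. -/
structure Transition (S Q C : Type) where
  src : Q
  tgt : Q
  letter : S
  reset : List C
  guard : ClockConstraint C

/-- A timed Büchi automaton with alphabet `S`, locations `Q` and clocks `C`. The (finite) sets of
initial locations, transitions and accepting locations are given by lists of their elements. -/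
structure TBA (S Q C : Type) where
  init : List Q
  trans : List (Transition S Q C)
  accept : List Q

/-- `(q 0, v 0) → (q 1, v 1) → ⋯ → (q n, v n)` is a finite run (a run prefix) of `A` that processes
`w` and starts in an initial location with all clocks equal to zero. -/
structure TBA.IsRunPrefix {S Q C : Type} (A : TBA S Q C) (w : TimedWord S)
    (q : Fin (w.len + 1) → Q) (v : Fin (w.len + 1) → C → ℝ≥0) : Prop where
  init_loc : q 0 ∈ A.init
  init_val : ∀ c, v 0 c = 0
  step : ∀ i : Fin w.len, ∃ t ∈ A.trans,
    t.src = q i.castSucc ∧ t.tgt = q i.succ ∧ t.letter = w.letter i ∧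
    t.guard.Sat (fun c => v i.castSucc c + w.delay i) ∧
    ∀ c, (c ∈ t.reset → v i.succ c = 0) ∧
      (c ∉ t.reset → v i.succ c = v i.castSucc c + w.delay i)

/-! ### Observations -/

/-- Propositional formulas whose propositions are the letters, the locations and the clock
constraints. -/
inductive Formula (S Q C : Type) where
  | letter (a : S)
  | loc (q : Q)
  | constraint (g : ClockConstraint C)
  | neg (φ : Formula S Q C)
  | conj (φ ψ : Formula S Q C)
  | disj (φ ψ : Formula S Q C)

/-- The satisfaction relation `a, (q, v) ⊨ φ`. -/
def Formula.Sat {S Q C : Type} (a : S) (q : Q) (v : C → ℝ≥0) : Formula S Q C → Prop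
  | .letter a' => a' = a
  | .loc q' => q' = q
  | .constraint g => g.Sat v
  | .neg φ => ¬ φ.Sat a q v
  | .conj φ ψ => φ.Sat a q v ∧ ψ.Sat a q v
  | .disj φ ψ => φ.Sat a q v ∨ ψ.Sat a q v

/-- A bounded interval of `ℝ≥0` with rational endpoints, each of which may or may not belong to
the interval. -/
structure RatInterval where
  lo : ℚ≥0
  hi : ℚ≥0
  loClosed : Bool
  hiClosed : Bool

/-- The set of points of an interval. -/
def RatInterval.toSet (I : RatInterval) : Set ℝ≥0 :=
  {x | (if I.loClosed then (I.lo : ℝ≥0) ≤ x else (I.lo : ℝ≥0) < x) ∧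
    (if I.hiClosed then x ≤ (I.hi : ℝ≥0) else x < (I.hi : ℝ≥0))}

/-- The multiplicities `≤ e`, `= e` and `≥ e`. -/
inductive Multiplicity where
  | le (e : ℕ)
  | eq (e : ℕ)
  | ge (e : ℕ)

/-- The number `k` of occurrences is allowed by the multiplicity. -/
def Multiplicity.Allows : Multiplicity → ℕ → Prop
  | .le e, k => k ≤ e
  | .eq e, k => k = e
  | .ge e, k => k ≥ e

/-- A triple `(φ, I, m)`. -/
structure ObsItem (S Q C : Type) where
  formula : Formula S Q C
  interval : RatInterval
  mult : Multiplicity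

/-- A (rational) observation for automata with alphabet `S`, locations `Q` and clocks `C`. -/
abbrev Observation (S Q C : Type) := List (ObsItem S Q C)

/-- The sequence `(q, v)` of states together with the map `h` from the positions of the word `w`
to the positions of the observation `o` satisfies the requirements of `o`. -/
structure Matches {S Q C : Type} (o : Observation S Q C) (w : TimedWord S)
    (q : Fin (w.len + 1) → Q) (v : Fin (w.len + 1) → C → ℝ≥0)
    (h : Fin w.len → Fin o.length) : Prop where
  mono : Monotone h
  formula : ∀ j, (o.get (h j)).formula.Sat (w.letter j) (q j.succ) (v j.succ)
  interval : ∀ j, w.time j ∈ (o.get (h j)).interval.toSet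
  mult : ∀ i : Fin o.length,
    (o.get i).mult.Allows (Finset.univ.filter fun j => h j = i).card

/-- The set of all finite timed words that are consistent with the observation `o`. -/
def TBA.consistentWords {S Q C : Type} (A : TBA S Q C) (o : Observation S Q C) :
    Set (TimedWord S) :=
  {w | ∃ (q : Fin (w.len + 1) → Q) (v : Fin (w.len + 1) → C → ℝ≥0)
    (h : Fin w.len → Fin o.length), A.IsRunPrefix w q v ∧ Matches o w q v h}

/-! ### Problem instances and their codes

An instance is a timed Büchi automaton together with an observation for it. As usual for inputs of
algorithms, the elements of the finite alphabet, of the finite set of locations and of the finite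
set of clocks are numbered. Its code writes down all its data by means of natural numbers. -/

structure Instance where
  numLetters : ℕ
  numLocs : ℕ
  numClocks : ℕ
  aut : TBA (Fin numLetters) (Fin numLocs) (Fin numClocks)
  obs : Observation (Fin numLetters) (Fin numLocs) (Fin numClocks)

def Cmp.code : Cmp → ℕ
  | .lt => 0
  | .le => 1
  | .eq => 2
  | .ge => 3
  | .gt => 4

abbrev ConstraintCode := List (ℕ × ℕ × ℕ)

def codeConstraint {c : ℕ} (g : ClockConstraint (Fin c)) : ConstraintCode :=
  g.map fun a => (a.clock.val, a.cmp.code, a.bound)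

abbrev TransitionCode := ℕ × ℕ × ℕ × List ℕ × ConstraintCode

def Transition.code {s n c : ℕ} (t : Transition (Fin s) (Fin n) (Fin c)) : TransitionCode :=
  (t.src.val, t.tgt.val, t.letter.val, t.reset.map Fin.val, codeConstraint t.guard)

/-- A formula is coded by the list of its symbols in prefix (Polish) notation. A symbol is a triple
of a tag, a number (the letter or location, `0` otherwise), and the code of a clock constraint
(empty unless the symbol is one). -/
abbrev FormulaCode := List (ℕ × ℕ × ConstraintCode)

def Formula.code {s n c : ℕ} : Formula (Fin s) (Fin n) (Fin c) → FormulaCode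
  | .letter a => [(0, a.val, [])]
  | .loc q => [(1, q.val, [])]
  | .constraint g => [(2, 0, codeConstraint g)]
  | .neg φ => (3, 0, []) :: φ.code
  | .conj φ ψ => (4, 0, []) :: (φ.code ++ ψ.code)
  | .disj φ ψ => (5, 0, []) :: (φ.code ++ ψ.code)

abbrev IntervalCode := (ℕ × ℕ) × (ℕ × ℕ) × Bool × Bool

/-- Rational endpoints are coded by numerator and denominator in lowest terms. -/
def RatInterval.code (I : RatInterval) : IntervalCode :=
  ((I.lo.num, I.lo.den), (I.hi.num, I.hi.den), I.loClosed, I.hiClosed)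

def Multiplicity.code : Multiplicity → ℕ × ℕ
  | .le e => (0, e)
  | .eq e => (1, e)
  | .ge e => (2, e)

abbrev ItemCode := FormulaCode × IntervalCode × (ℕ × ℕ)

def ObsItem.code {s n c : ℕ} (x : ObsItem (Fin s) (Fin n) (Fin c)) : ItemCode :=
  (x.formula.code, x.interval.code, x.mult.code)

abbrev InstanceCode :=
  (ℕ × ℕ × ℕ) × (List ℕ × List TransitionCode × List ℕ) × List ItemCode

/-- The input that is handed to an algorithm. -/
def Instance.code (P : Instance) : InstanceCode :=
  ((P.numLetters, P.numLocs, P.numClocks),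
    (P.aut.init.map Fin.val, P.aut.trans.map Transition.code, P.aut.accept.map Fin.val),
    P.obs.map ObsItem.code)

end TimedMon

namespace TimedMon

/-! ### Configurations -/

/-! Consistency is turned into reachability. A configuration records absolute time and absolute
reset times, together with the current position in the observation and the number of letters matched
there. A step either reads a letter or closes the current position once its multiplicity is met. By
`consistentWords_nonempty_iff`, a consistent word exists iff the end of the observation is
reachable.

The state space is uncountable, but it has a finite bisimulation quotient. Let `D` be a common
denominator of the interval endpoints. Two configurations are equivalent if they agree on location,
position and capped count, and if all differences of the points 0, current time and reset times have
equal integer parts after scaling by `D`. Both orders of a difference are recorded, so these integer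
parts also tell which differences are integers; hence guards, formulas and intervals cannot separate
equivalent configurations. `exists_floor_sub_eq` finds, for any new time on one side, a matching
time on the other, and so gives the bisimulation `Step.lift`. The intervals are bounded, so all
times stay below some `M` and there are finitely many regions, however large the guard constants
are.

A shortest path visits no region twice, so its length is less than the number of regions
(`ReachIn.exists_lt_card`). Matching times can be chosen at the cost of one binary digit per step,
so a path with at most `N` steps can be realised with all times in multiples of `1 / (D * 2 ^ N)`
(`exists_reachIn_onGrid`). On that grid, exhaustive search with natural numbers is exact
(`search_iff`). The encoding of the input bounds every number in it, which supplies `D`, `M` and `N`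
by primitive recursive formulas. -/

/-- A configuration: a location, the current time, the times of the last resets of the clocks, the
current position in the observation, and the number of letters read at this position. -/
structure Cfg (Q C : Type) where
  loc : Q
  time : ℝ
  rst : C → ℝ
  idx : ℕ
  cnt : ℕ

variable {S Q C : Type}

/-- The clock values in a configuration. -/
noncomputable def Cfg.val (x : Cfg Q C) (c : C) : ℝ≥0 := (x.time - x.rst c).toNNReal

/-- The configuration at the beginning of a run. -/
def Cfg.start (q : Q) : Cfg Q C := ⟨q, 0, fun _ => 0, 0, 0⟩

/-- Proceed to the next position of the observation. -/
def Cfg.advance (x : Cfg Q C) : Cfg Q C := ⟨x.loc, x.time, x.rst, x.idx + 1, 0⟩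

open Classical in
/-- Take the transition `t` at time `s`. -/
noncomputable def Cfg.read (x : Cfg Q C) (t : Transition S Q C) (s : ℝ) : Cfg Q C :=
  ⟨t.tgt, s, fun c => if c ∈ t.reset then s else x.rst c, x.idx, x.cnt + 1⟩

/-- The steps between configurations. -/
inductive Step (A : TBA S Q C) (o : Observation S Q C) : Cfg Q C → Cfg Q C → Prop
  | advance (x : Cfg Q C) (it : ObsItem S Q C) (hit : o[x.idx]? = some it)
      (hm : it.mult.Allows x.cnt) : Step A o x x.advance
  | read (x : Cfg Q C) (it : ObsItem S Q C) (hit : o[x.idx]? = some it)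
      (t : Transition S Q C) (ht : t ∈ A.trans) (hsrc : t.src = x.loc) (s : ℝ) (hs : x.time ≤ s)
      (hg : t.guard.Sat fun c => (s - x.rst c).toNNReal)
      (hf : it.formula.Sat t.letter t.tgt (x.read t s).val)
      (hi : s.toNNReal ∈ it.interval.toSet) : Step A o x (x.read t s)

/-! ### From step sequences to consistent words -/

theorem card_filter_snoc {n : ℕ} (h : Fin n → ℕ) (a i : ℕ) :
    (Finset.univ.filter fun j => Fin.snoc (α := fun _ => ℕ) h a j = i).card
      = (Finset.univ.filter fun j => h j = i).card + if a = i then 1 else 0 := by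
  simp only [Finset.card_filter, Fin.sum_univ_castSucc, Fin.snoc_castSucc, Fin.snoc_last]

/-- The configuration `x` is reached by a run prefix that obeys the observation so far. -/
def IsTraced (A : TBA S Q C) (o : Observation S Q C) (x : Cfg Q C) : Prop :=
  ∃ (w : TimedWord S) (q : Fin (w.len + 1) → Q) (v : Fin (w.len + 1) → C → ℝ≥0)
    (h : Fin w.len → ℕ), A.IsRunPrefix w q v ∧ q (Fin.last _) = x.loc ∧
    (w.stamp (Fin.last _) : ℝ) = x.time ∧ (∀ c, (v (Fin.last _) c : ℝ) = x.time - x.rst c) ∧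
    Monotone h ∧ (∀ j, h j ≤ x.idx) ∧
    (∀ j, ∃ it, o[h j]? = some it ∧ it.formula.Sat (w.letter j) (q j.succ) (v j.succ) ∧
      w.time j ∈ it.interval.toSet) ∧
    (∀ i < x.idx, ∃ it, o[i]? = some it ∧
      it.mult.Allows (Finset.univ.filter fun j => h j = i).card) ∧
    (Finset.univ.filter fun j => h j = x.idx).card = x.cnt

theorem isTraced_start {A : TBA S Q C} {o : Observation S Q C} {q : Q} (hq : q ∈ A.init) :
    IsTraced A o (Cfg.start q) :=
  ⟨⟨0, Fin.elim0, Fin.elim0, fun a => a.elim0⟩, fun _ => q, fun _ _ => 0, Fin.elim0,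
    ⟨hq, fun _ => rfl, fun i => i.elim0⟩, rfl, by simp [TimedWord.stamp, Cfg.start],
    by simp [Cfg.start], fun a => a.elim0, fun a => a.elim0, fun a => a.elim0,
    by simp [Cfg.start], by simp [Cfg.start]⟩

theorem IsTraced.advance {A : TBA S Q C} {o : Observation S Q C} {x : Cfg Q C}
    (hx : IsTraced A o x) {it : ObsItem S Q C} (hit : o[x.idx]? = some it)
    (hm : it.mult.Allows x.cnt) : IsTraced A o x.advance := by
  obtain ⟨w, q, v, h, hr, hq, ht, hv, hmono, hle, hf, hcount, hc⟩ := hx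
  refine ⟨w, q, v, h, hr, hq, ht, hv, hmono, fun j => (hle j).trans (Nat.le_succ _), hf, ?_, ?_⟩
  · intro i hi
    rcases Nat.lt_succ_iff_lt_or_eq.1 hi with hi | rfl
    · exact hcount i hi
    · exact ⟨it, hit, by rwa [hc]⟩
  -- The new position exceeds every value of `h`, so its count starts at zero.
  · rw [show x.advance.cnt = 0 from rfl, Finset.card_eq_zero, Finset.filter_eq_empty_iff]
    intro j _ hj
    have := hle j
    rw [hj] at this
    exact Nat.not_succ_le_self _ this

/-- Append a letter to a timed word. -/
def TimedWord.snoc (w : TimedWord S) (a : S) (s : ℝ≥0) (hs : w.stamp (Fin.last _) ≤ s) :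
    TimedWord S where
  len := w.len + 1
  letter := Fin.snoc (α := fun _ => S) w.letter a
  time := Fin.snoc (α := fun _ => ℝ≥0) w.time s
  mono := by
    have key : ∀ i, w.time i ≤ s := by
      intro i
      refine le_trans ?_ hs
      obtain ⟨n, l, t, hm⟩ := w
      cases n with
      | zero => exact i.elim0
      | succ n =>
        have : Fin.last (n + 1) = (Fin.last n).succ := rfl
        simp only [TimedWord.stamp, this, Fin.cons_succ]
        exact hm (Fin.le_last i)
    intro i j hij
    induction j using Fin.lastCases with
    | last =>
      rw [Fin.snoc_last]
      induction i using Fin.lastCases with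
      | last => rw [Fin.snoc_last]
      | cast i => rw [Fin.snoc_castSucc]; exact key i
    | cast j =>
      induction i using Fin.lastCases with
      | last => exact absurd (lt_of_lt_of_le (Fin.castSucc_lt_last j) hij) (lt_irrefl _)
      | cast i =>
        rw [Fin.snoc_castSucc, Fin.snoc_castSucc]
        exact w.mono (by simpa using hij)

theorem TimedWord.stamp_snoc (w : TimedWord S) (a : S) (s : ℝ≥0) (hs) :
    (w.snoc a s hs).stamp = Fin.snoc (α := fun _ => ℝ≥0) w.stamp s :=
  Fin.cons_snoc_eq_snoc_cons (β := ℝ≥0) 0 w.time s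

/-- Transports satisfaction along equalities such as those for `Fin.snoc`, where rewriting would
have to go through dependent indices. -/
theorem Formula.sat_congr {a a' : S} {q q' : Q} {v v' : C → ℝ≥0} {φ : Formula S Q C} (ha : a' = a)
    (hq : q' = q) (hv : v' = v) (h : φ.Sat a q v) : φ.Sat a' q' v' := by
  subst ha hq hv; exact h

open Classical in
theorem IsTraced.read {A : TBA S Q C} {o : Observation S Q C} {x : Cfg Q C}
    (hx : IsTraced A o x) {it : ObsItem S Q C} (hit : o[x.idx]? = some it)
    {t : Transition S Q C} (ht : t ∈ A.trans) (hsrc : t.src = x.loc) {s : ℝ} (hs : x.time ≤ s)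
    (hg : t.guard.Sat fun c => (s - x.rst c).toNNReal)
    (hf : it.formula.Sat t.letter t.tgt (x.read t s).val)
    (hi : s.toNNReal ∈ it.interval.toSet) : IsTraced A o (x.read t s) := by
  obtain ⟨w, q, v, h, hr, hq, hst, hv, hmono, hle, hform, hcount, hc⟩ := hx
  have hs0 : 0 ≤ s := le_trans (by rw [← hst]; positivity) hs
  have hsle : w.stamp (Fin.last _) ≤ s.toNNReal := by
    rw [← NNReal.coe_le_coe, Real.coe_toNNReal _ hs0, hst]; exact hs
  let w' := w.snoc t.letter s.toNNReal hsle
  let q' : Fin (w.len + 1 + 1) → Q := Fin.snoc (α := fun _ => Q) q t.tgt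
  let v' : Fin (w.len + 1 + 1) → C → ℝ≥0 :=
    Fin.snoc (α := fun _ => C → ℝ≥0) v (x.read t s).val
  have hq1 : ∀ i, q' i.castSucc = q i := fun i => Fin.snoc_castSucc (α := fun _ => Q) ..
  have hq2 : q' (Fin.last _) = t.tgt := Fin.snoc_last (α := fun _ => Q) ..
  have hv1 : ∀ i, v' i.castSucc = v i := fun i => Fin.snoc_castSucc (α := fun _ => C → ℝ≥0) ..
  have hv2 : v' (Fin.last _) = (x.read t s).val := Fin.snoc_last (α := fun _ => C → ℝ≥0) ..
  have hl1 : ∀ i : Fin w.len, w'.letter i.castSucc = w.letter i :=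
    fun i => Fin.snoc_castSucc (α := fun _ => S) ..
  have hl2 : w'.letter (Fin.last _) = t.letter := Fin.snoc_last (α := fun _ => S) ..
  have ht1 : ∀ i : Fin w.len, w'.time i.castSucc = w.time i :=
    fun i => Fin.snoc_castSucc (α := fun _ => ℝ≥0) ..
  have ht2 : w'.time (Fin.last _) = s.toNNReal := Fin.snoc_last (α := fun _ => ℝ≥0) ..
  have hs1 : ∀ i : Fin (w.len + 1), w'.stamp i.castSucc = w.stamp i := by
    intro i
    rw [TimedWord.stamp_snoc]; exact Fin.snoc_castSucc (α := fun _ => ℝ≥0) ..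
  have hs2 : w'.stamp (Fin.last _) = s.toNNReal := by
    rw [TimedWord.stamp_snoc]; exact Fin.snoc_last (α := fun _ => ℝ≥0) ..
  have hd1 : ∀ i : Fin w.len, w'.delay i.castSucc = w.delay i := by
    intro i
    show w'.stamp i.succ.castSucc - w'.stamp i.castSucc.castSucc = _
    rw [hs1, hs1]; rfl
  have hd2 : w'.delay (Fin.last _) = s.toNNReal - w.stamp (Fin.last _) := by
    show w'.stamp (Fin.last _) - w'.stamp (Fin.last _).castSucc = _
    rw [hs1, hs2]
  have hd3 : ∀ c, v (Fin.last _) c + w'.delay (Fin.last _) = (s - x.rst c).toNNReal := by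
    intro c
    -- The clock value `x.time - x.rst c` is nonnegative and `s` is not earlier than `x.time`, so
    -- `toNNReal` truncates nothing.
    have h1 : 0 ≤ s - x.rst c := by
      have := hv c
      have h2 : (0 : ℝ) ≤ v (Fin.last _) c := by positivity
      linarith
    rw [hd2, ← NNReal.coe_inj, NNReal.coe_add, NNReal.coe_sub hsle, hv,
      Real.coe_toNNReal _ h1, Real.coe_toNNReal _ hs0, hst]
    ring
  refine ⟨w', q', v', Fin.snoc (α := fun _ => ℕ) h x.idx, ⟨?_, ?_, ?_⟩, hq2, ?_, ?_, ?_, ?_, ?_,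
    ?_, ?_⟩
  · exact (hq1 0).symm ▸ hr.init_loc
  · intro c
    exact (congrFun (hv1 0) c).trans (hr.init_val c)
  · intro i
    induction i using Fin.lastCases with
    | last =>
      refine ⟨t, ht, ?_, ?_, hl2.symm, ?_, ?_⟩
      · rw [hsrc, ← hq]; exact (hq1 _).symm
      · exact hq2.symm
      · have : (fun c => v' (Fin.last w.len).castSucc c + w'.delay (Fin.last _))
            = fun c => (s - x.rst c).toNNReal := by
          funext c; rw [hv1, hd3]
        exact this ▸ hg
      · intro c
        have e : v' (Fin.last w.len).succ c = (s - if c ∈ t.reset then s else x.rst c).toNNReal :=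
          congrFun hv2 c
        constructor
        · intro hcr
          exact e.trans (by simp [hcr])
        · intro hcr
          refine e.trans ?_
          rw [if_neg hcr, ← hd3 c, ← hv1]; rfl
    | cast i =>
      obtain ⟨t', h1, h2, h3, h4, h5, h6⟩ := hr.step i
      refine ⟨t', h1, h2.trans (hq1 _).symm, h3.trans (hq1 i.succ).symm, h4.trans (hl1 i).symm,
        ?_, ?_⟩
      · have : (fun c => v' i.castSucc.castSucc c + w'.delay i.castSucc)
            = fun c => v i.castSucc c + w.delay i := by
          funext c; rw [hv1, hd1]
        exact this ▸ h5
      · intro c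
        have e1 : v' i.castSucc.succ c = v i.succ c := congrFun (hv1 i.succ) c
        have e2 : v' i.castSucc.castSucc c = v i.castSucc c := congrFun (hv1 i.castSucc) c
        exact ⟨fun hcr => e1.trans ((h6 c).1 hcr), fun hcr => e1.trans (((h6 c).2 hcr).trans
          (by rw [← e2, ← hd1]; rfl))⟩
  · exact (congrArg _ hs2).trans (Real.coe_toNNReal _ hs0)
  · intro c
    refine (congrArg (fun f : C → ℝ≥0 => (f c : ℝ)) hv2).trans ?_
    refine Real.coe_toNNReal _ ?_
    simp only [Cfg.read]
    split_ifs
    · simp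
    · have := hv c
      have h2 : (0 : ℝ) ≤ v (Fin.last _) c := by positivity
      linarith
  · intro i j hij
    induction j using Fin.lastCases with
    | last =>
      rw [Fin.snoc_last]
      induction i using Fin.lastCases with
      | last => rw [Fin.snoc_last]
      | cast i => rw [Fin.snoc_castSucc]; exact hle i
    | cast j =>
      induction i using Fin.lastCases with
      | last => exact absurd (lt_of_lt_of_le (Fin.castSucc_lt_last j) hij) (lt_irrefl _)
      | cast i =>
        rw [Fin.snoc_castSucc, Fin.snoc_castSucc]
        exact hmono (Fin.castSucc_le_castSucc_iff.1 hij)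
  · intro j
    induction j using Fin.lastCases with
    | last => rw [Fin.snoc_last]; exact le_rfl
    | cast j => rw [Fin.snoc_castSucc]; exact hle j
  · intro j
    induction j using Fin.lastCases with
    | last =>
      rw [Fin.snoc_last]
      refine ⟨it, hit, ?_, ht2 ▸ hi⟩
      exact Formula.sat_congr hl2 hq2 hv2 hf
    | cast j =>
      rw [Fin.snoc_castSucc]
      obtain ⟨it', h1, h2, h3⟩ := hform j
      exact ⟨it', h1, Formula.sat_congr (hl1 j) (hq1 j.succ) (hv1 j.succ) h2,
        (ht1 j).symm ▸ h3⟩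
  · intro i hix
    obtain ⟨it', h1, h2⟩ := hcount i hix
    refine ⟨it', h1, ?_⟩
    have := card_filter_snoc h x.idx i
    rw [if_neg (by exact Nat.ne_of_gt hix), add_zero] at this
    exact this ▸ h2
  · have := card_filter_snoc h x.idx x.idx
    rw [if_pos rfl, hc] at this
    exact this

theorem IsTraced.step {A : TBA S Q C} {o : Observation S Q C} {x y : Cfg Q C}
    (hx : IsTraced A o x) (h : Step A o x y) : IsTraced A o y := by
  cases h with
  | advance it hit hm => exact hx.advance hit hm
  | read it hit t ht hsrc s hs hg hf hi => exact hx.read hit ht hsrc hs hg hf hi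

/-- Each letter was read at an existing item, so `h` takes values in the positions of `o`; at the
end of `o` every count has been checked. -/
theorem IsTraced.nonempty {A : TBA S Q C} {o : Observation S Q C} {x : Cfg Q C}
    (hx : IsTraced A o x) (hidx : x.idx = o.length) : (A.consistentWords o).Nonempty := by
  obtain ⟨w, q, v, h, hr, hq, hst, hv, hmono, hle, hform, hcount, hc⟩ := hx
  have hlt : ∀ j, h j < o.length := by
    intro j
    obtain ⟨it, hit, -⟩ := hform j
    exact (List.getElem?_eq_some_iff.1 hit).1
  refine ⟨w, q, v, fun j => ⟨h j, hlt j⟩, hr, fun i j hij => hmono hij, ?_, ?_, ?_⟩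
  · intro j
    obtain ⟨it, hit, h1, h2⟩ := hform j
    obtain ⟨_, rfl⟩ := List.getElem?_eq_some_iff.1 hit
    exact h1
  · intro j
    obtain ⟨it, hit, h1, h2⟩ := hform j
    obtain ⟨_, rfl⟩ := List.getElem?_eq_some_iff.1 hit
    exact h2
  · intro i
    obtain ⟨it, hit, h1⟩ := hcount i (by rw [hidx]; exact i.2)
    obtain ⟨_, rfl⟩ := List.getElem?_eq_some_iff.1 hit
    simpa [Fin.ext_iff] using h1

/-! ### From consistent words to step sequences -/

/-- The configuration of a matched run after `j` letters, at position `i` of the observation. -/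
noncomputable def runCfg {o : Observation S Q C} {w : TimedWord S} (q : Fin (w.len + 1) → Q)
    (v : Fin (w.len + 1) → C → ℝ≥0) (h : Fin w.len → Fin o.length) (j : Fin (w.len + 1)) (i : ℕ) :
    Cfg Q C :=
  ⟨q j, w.stamp j, fun c => w.stamp j - v j c, i,
    (Finset.univ.filter fun k : Fin w.len => k.castSucc < j ∧ (h k : ℕ) = i).card⟩

theorem TimedWord.stamp_le_succ (w : TimedWord S) (j : Fin w.len) :
    w.stamp j.castSucc ≤ w.stamp j.succ := by
  obtain ⟨n, l, t, hm⟩ := w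
  cases n with
  | zero => exact j.elim0
  | succ n =>
    induction j using Fin.cases with
    | zero => exact zero_le
    | succ j =>
      simp only [TimedWord.stamp, Fin.cons_succ, ← Fin.succ_castSucc]
      exact hm (Fin.castSucc_lt_succ).le

/-- By `h2` no letter from `j` on is matched to position `i`, so the count so far is the full one,
which the multiplicity allows. By `h1` no earlier letter is matched to `i + 1`, so the new count is
zero. -/
theorem step_runCfg_advance (A : TBA S Q C) {o : Observation S Q C} {w : TimedWord S}
    {q : Fin (w.len + 1) → Q} {v : Fin (w.len + 1) → C → ℝ≥0} {h : Fin w.len → Fin o.length}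
    (hm : Matches o w q v h) (j : Fin (w.len + 1)) (i : ℕ) (hi : i < o.length)
    (h1 : ∀ k : Fin w.len, k.castSucc < j → (h k : ℕ) ≤ i)
    (h2 : ∀ k : Fin w.len, j ≤ k.castSucc → i < h k) :
    Step A o (runCfg q v h j i) (runCfg q v h j (i + 1)) := by
  have key : Step A o (runCfg q v h j i) (runCfg q v h j i).advance := by
    refine Step.advance _ o[i] (List.getElem?_eq_getElem hi) ?_
    have := hm.mult ⟨i, hi⟩
    convert this using 1
    · rfl
    simp only [runCfg]
    congr 1
    ext k
    have := h2 k
    simp only [Finset.mem_filter, Finset.mem_univ, true_and, Fin.ext_iff]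
    refine ⟨fun hk => hk.2, fun hk => ⟨?_, hk⟩⟩
    by_contra hlt
    have := this (not_lt.1 hlt)
    omega
  convert key using 1
  simp only [runCfg, Cfg.advance, Cfg.mk.injEq, Finset.card_eq_zero, Finset.filter_eq_empty_iff,
    true_and]
  rintro k - ⟨hk, hk'⟩
  have := h1 k hk
  omega

theorem step_runCfg_read {A : TBA S Q C} {o : Observation S Q C} {w : TimedWord S}
    {q : Fin (w.len + 1) → Q} {v : Fin (w.len + 1) → C → ℝ≥0} {h : Fin w.len → Fin o.length}
    (hr : A.IsRunPrefix w q v) (hm : Matches o w q v h) (j : Fin w.len) :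
    Step A o (runCfg q v h j.castSucc (h j)) (runCfg q v h j.succ (h j)) := by
  classical
  obtain ⟨t, ht, hsrc, htgt, hl, hg, hv⟩ := hr.step j
  have hd : (w.delay j : ℝ) = w.stamp j.succ - w.stamp j.castSucc :=
    NNReal.coe_sub (w.stamp_le_succ j)
  have hrst : (runCfg q v h j.succ (h j)).rst =
      ((runCfg q v h j.castSucc (h j)).read t (w.stamp j.succ)).rst := by
    funext c
    simp only [runCfg, Cfg.read]
    split_ifs with hc
    · simp [(hv c).1 hc]
    · rw [(hv c).2 hc, NNReal.coe_add, hd]; ring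
  have hcfg : runCfg q v h j.succ (h j) =
      (runCfg q v h j.castSucc (h j)).read t (w.stamp j.succ) := by
    have e := hrst
    simp only [runCfg, Cfg.read, Cfg.mk.injEq] at e ⊢
    refine ⟨htgt.symm, trivial, e, trivial, ?_⟩
    rw [← Finset.card_insert_of_notMem (a := j) (by simp)]
    refine congrArg Finset.card ?_
    ext k
    simp only [Finset.mem_filter, Finset.mem_univ, true_and, Finset.mem_insert,
      Fin.castSucc_lt_succ_iff, Fin.castSucc_lt_castSucc_iff]
    constructor
    · rintro ⟨h1, h2⟩
      rcases h1.eq_or_lt with h1 | h1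
      · exact Or.inl h1
      · exact Or.inr ⟨h1, h2⟩
    · rintro (rfl | h1)
      · exact ⟨le_rfl, rfl⟩
      · exact ⟨h1.1.le, h1.2⟩
  rw [hcfg]
  refine Step.read _ _ (List.getElem?_eq_getElem (h j).2) t ht hsrc _ ?_ ?_ ?_ ?_
  · exact NNReal.coe_le_coe.2 (w.stamp_le_succ j)
  · convert hg using 2 with c
    rw [← NNReal.coe_inj, NNReal.coe_add, hd, Real.coe_toNNReal]
    · simp only [runCfg]; ring
    · have h1 : (w.stamp j.castSucc : ℝ) ≤ w.stamp j.succ := NNReal.coe_le_coe.2 (w.stamp_le_succ j)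
      have h2 : (0 : ℝ) ≤ v j.castSucc c := by positivity
      simp only [runCfg]; linarith
  · refine Formula.sat_congr hl htgt ?_ (hm.formula j)
    rw [← hcfg]
    funext c
    simp [Cfg.val, runCfg]
  · have := hm.interval j
    rw [Real.toNNReal_coe]
    exact this

/-- Monotonicity of `h` makes the matched run a staircase path of pairs `(j, i)`; `h1` and `h2` say
that a pair separates the letters read from those to come. The last step to a pair is a read if
letter `j` is matched to position `i`, and an advance otherwise, whence the nested induction. -/
theorem reach_runCfg {A : TBA S Q C} {o : Observation S Q C} {w : TimedWord S}
    {q : Fin (w.len + 1) → Q} {v : Fin (w.len + 1) → C → ℝ≥0} {h : Fin w.len → Fin o.length}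
    (hr : A.IsRunPrefix w q v) (hm : Matches o w q v h) (j : Fin (w.len + 1)) (i : ℕ)
    (hi : i ≤ o.length) (h1 : ∀ k : Fin w.len, k.castSucc < j → (h k : ℕ) ≤ i)
    (h2 : ∀ k : Fin w.len, j ≤ k.castSucc → i ≤ h k) :
    Relation.ReflTransGen (Step A o) (Cfg.start (q 0)) (runCfg q v h j i) := by
  induction j using Fin.induction generalizing i with
  | zero =>
    induction i with
    | zero =>
      have : runCfg q v h 0 0 = Cfg.start (q 0) := by
        simp [runCfg, Cfg.start, TimedWord.stamp, hr.init_val]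
      rw [this]
    | succ i ih =>
      exact (ih (by omega) (by simp) (fun k hk => (Nat.le_succ i).trans (h2 k hk))).tail
        (step_runCfg_advance A hm _ i hi (by simp) h2)
  | succ j ih0 =>
    have hmono : ∀ k : Fin w.len, k.castSucc < j.succ → (h k : ℕ) ≤ h j :=
      fun k hk => hm.mono (Fin.castSucc_lt_succ_iff.1 hk)
    induction i with
    | zero =>
      have hj : (h j : ℕ) = 0 := Nat.le_zero.1 (h1 j Fin.castSucc_lt_succ)
      have := step_runCfg_read hr hm j
      rw [hj] at this
      exact (ih0 0 hi (fun k hk => h1 k (hk.trans Fin.castSucc_lt_succ))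
        (fun k _ => Nat.zero_le _)).tail this
    | succ i ih =>
      by_cases hj : (h j : ℕ) = i + 1
      · have := step_runCfg_read hr hm j
        rw [hj] at this
        refine (ih0 _ hi (fun k hk => h1 k (hk.trans Fin.castSucc_lt_succ)) fun k hk => ?_).tail
          this
        rw [← hj]
        exact hm.mono (Fin.castSucc_le_castSucc_iff.1 hk)
      · have hj' : (h j : ℕ) ≤ i := by
          have := h1 j Fin.castSucc_lt_succ
          omega
        have h1' : ∀ k : Fin w.len, k.castSucc < j.succ → (h k : ℕ) ≤ i :=
          fun k hk => (hmono k hk).trans hj'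
        exact (ih (by omega) h1' (fun k hk => (Nat.le_succ i).trans (h2 k hk))).tail
          (step_runCfg_advance A hm _ i hi h1' h2)

/-- Some word is consistent with the observation if and only if the end of the observation can be
reached by steps between configurations. -/
theorem consistentWords_nonempty_iff (A : TBA S Q C) (o : Observation S Q C) :
    (A.consistentWords o).Nonempty ↔ ∃ q ∈ A.init, ∃ x,
      Relation.ReflTransGen (Step A o) (Cfg.start q) x ∧ x.idx = o.length := by
  constructor
  · rintro ⟨w, q, v, h, hr, hm⟩
    exact ⟨q 0, hr.init_loc, _, reach_runCfg hr hm (Fin.last _) o.length le_rfl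
      (fun k _ => (h k).2.le)
      (fun k hk => absurd (Fin.castSucc_lt_last k) (not_lt.2 hk)), rfl⟩
  · rintro ⟨q, hq, x, hx, hidx⟩
    refine IsTraced.nonempty ?_ hidx
    clear hidx
    induction hx with
    | refl => exact isTraced_start hq
    | tail _ h ih => exact ih.step h

/-! ### Reachability in a bounded number of steps -/

/-- `z` is reached from `x` in exactly `n` steps. -/
def ReachIn {X : Type*} (R : X → X → Prop) : ℕ → X → X → Prop
  | 0, x, z => x = z
  | n + 1, x, z => ∃ y, R x y ∧ ReachIn R n y z

section ReachIn

variable {X A : Type*} {R : X → X → Prop}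

theorem ReachIn.add {m n : ℕ} {x y z : X} (h : ReachIn R m x y) (h' : ReachIn R n y z) :
    ReachIn R (m + n) x z := by
  induction m generalizing x with
  | zero => obtain rfl : x = y := h; simpa using h'
  | succ m ih =>
    obtain ⟨u, hu, hu'⟩ := h
    rw [Nat.succ_add]
    exact ⟨u, hu, ih hu'⟩

theorem ReachIn.split {n i : ℕ} {x z : X} (h : ReachIn R n x z) (hi : i ≤ n) :
    ∃ y, ReachIn R i x y ∧ ReachIn R (n - i) y z := by
  induction i generalizing x n with
  | zero => exact ⟨x, rfl, h⟩
  | succ i ih =>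
    obtain ⟨n, rfl⟩ : ∃ k, n = k + 1 := ⟨n - 1, by omega⟩
    obtain ⟨u, hu, hu'⟩ := h
    obtain ⟨y, h1, h2⟩ := ih hu' (by omega)
    exact ⟨y, ⟨u, hu, h1⟩, by simpa using h2⟩

theorem exists_reachIn_of_reflTransGen {x z : X} (h : Relation.ReflTransGen R x z) :
    ∃ n, ReachIn R n x z := by
  induction h with
  | refl => exact ⟨0, rfl⟩
  | tail _ h ih =>
    obtain ⟨n, hn⟩ := ih
    exact ⟨n + 1, hn.add (n := 1) ⟨_, h, rfl⟩⟩

theorem ReachIn.reflTransGen {n : ℕ} {x z : X} (h : ReachIn R n x z) :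
    Relation.ReflTransGen R x z := by
  induction n generalizing x with
  | zero => obtain rfl : x = z := h; exact .refl
  | succ n ih => obtain ⟨y, h1, h2⟩ := h; exact .head h1 (ih h2)

theorem ReachIn.inv {I : X → Prop} (hI : ∀ x y, I x → R x y → I y) {n : ℕ} {x z : X}
    (h : ReachIn R n x z) (hx : I x) : I z := by
  induction n generalizing x with
  | zero => obtain rfl : x = z := h; exact hx
  | succ n ih => obtain ⟨y, h1, h2⟩ := h; exact ih h2 (hI _ _ hx h1)

/-- Serves both for moving a path within the region quotient and for passing between configurations
and their codes. -/
theorem ReachIn.simulate {Y : Type*} {R' : Y → Y → Prop} {V : X → Y → Prop}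
    (h : ∀ x y x', V x y → R x x' → ∃ y', R' y y' ∧ V x' y') {n : ℕ} {x z : X} {y : Y}
    (hxy : V x y) (hx : ReachIn R n x z) : ∃ z', ReachIn R' n y z' ∧ V z z' := by
  induction n generalizing x y with
  | zero => obtain rfl : x = z := hx; exact ⟨y, rfl, hxy⟩
  | succ n ih =>
    obtain ⟨u, h1, h2⟩ := hx
    obtain ⟨u', h3, h4⟩ := h _ _ _ hxy h1
    obtain ⟨z', h5, h6⟩ := ih h4 h2
    exact ⟨z', ⟨u', h3, h5⟩, h6⟩

/-- If the reachable states have a finite bisimulation quotient, then a set of states that is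
invariant under it is reached in fewer steps than this quotient has elements. -/
theorem ReachIn.exists_lt_card {abs : X → A}
    (hsim : ∀ x y x', abs x = abs y → R x x' → ∃ y', R y y' ∧ abs x' = abs y')
    {I : X → Prop} (hI : ∀ x y, I x → R x y → I y) (F : Finset A) (hF : ∀ x, I x → abs x ∈ F)
    {G : X → Prop} (hG : ∀ x y, abs x = abs y → G x → G y) {n : ℕ} {x z : X}
    (hx : I x) (h : ReachIn R n x z) (hz : G z) :
    ∃ m < F.card, ∃ z', ReachIn R m x z' ∧ G z' := by
  classical
  have hex : ∃ m, ∃ z', ReachIn R m x z' ∧ G z' := ⟨n, z, h, hz⟩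
  obtain ⟨z', hz', hgz⟩ := Nat.find_spec hex
  refine ⟨Nat.find hex, ?_, z', hz', hgz⟩
  by_contra hlt
  have hlt := not_lt.1 hlt
  have hsplit : ∀ i : Fin (Nat.find hex + 1), ∃ y, ReachIn R i x y ∧
      ReachIn R (Nat.find hex - i) y z' := fun i => hz'.split (Nat.lt_succ_iff.1 i.2)
  choose f hf1 hf2 using hsplit
  obtain ⟨i, -, j, -, hij, habs⟩ := Finset.exists_ne_map_eq_of_card_lt_of_maps_to
    (s := (Finset.univ : Finset (Fin (Nat.find hex + 1)))) (t := F) (f := fun i => abs (f i))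
    (by rw [Finset.card_univ, Fintype.card_fin]; omega)
    (fun i _ => hF _ ((hf1 i).inv hI hx))
  -- A minimal path with a repeated class can be shortened: the part after the later visit is
  -- replayed from the earlier one.
  wlog hlt' : i < j generalizing i j
  · exact this j i hij.symm habs.symm (lt_of_le_of_ne (not_lt.1 hlt') hij.symm)
  obtain ⟨w, hw1, hw2⟩ := (hf2 j).simulate (V := fun x y => abs x = abs y) hsim habs.symm
  refine Nat.find_min hex (m := i + (Nat.find hex - j)) ?_ ⟨w, (hf1 i).add hw1, hG _ _ hw2 hgz⟩
  have := j.2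
  have : (i : ℕ) < j := hlt'
  omega

end ReachIn

/-! ### Tuples of reals with the same integer parts of all differences -/

theorem floor_eq_and_floor_neg_eq {a : ℝ} {n : ℤ} (h1 : n < a) (h2 : a < n + 1) :
    ⌊a⌋ = n ∧ ⌊-a⌋ = -n - 1 := by
  constructor
  · rw [Int.floor_eq_iff]; exact ⟨h1.le, h2⟩
  · rw [Int.floor_eq_iff]; push_cast; constructor <;> linarith

/-- If two tuples have the same integer parts of differences, then so do suitable extensions of
both; the precision of the new entry is at most one binary digit more. -/
theorem exists_floor_sub_eq {ι : Type*} [Finite ι] [Nonempty ι] (u w : ι → ℝ)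
    (h : ∀ i j, ⌊u i - u j⌋ = ⌊w i - w j⌋) (s : ℝ) :
    ∃ s', (∀ i, ⌊s - u i⌋ = ⌊s' - w i⌋) ∧ (∀ i, ⌊u i - s⌋ = ⌊w i - s'⌋) ∧
      ∀ k : ℕ, (∀ i, ∃ z : ℤ, w i * 2 ^ k = z) → ∃ z : ℤ, s' * 2 ^ (k + 1) = z := by
  -- If `s` is at an integer distance from some entry, the new time is forced, and no precision is
  -- lost.
  by_cases hint : ∃ (i : ι) (n : ℤ), s - u i = n
  · obtain ⟨i, n, hn⟩ := hint
    obtain rfl : s = u i + n := by linarith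
    refine ⟨w i + n, fun j => ?_, fun j => ?_, fun k hk => ?_⟩
    · rw [show u i + n - u j = u i - u j + n by ring, show w i + n - w j = w i - w j + n by ring,
        Int.floor_add_intCast, Int.floor_add_intCast, h]
    · rw [show u j - (u i + n) = u j - u i - n by ring,
        show w j - (w i + n) = w j - w i - n by ring,
        Int.floor_sub_intCast, Int.floor_sub_intCast, h]
    · obtain ⟨z, hz⟩ := hk i
      refine ⟨2 * z + n * 2 ^ (k + 1), ?_⟩
      push_cast
      rw [← hz]; ring
  · push Not at hint
    have ha : ∀ i, (⌊s - u i⌋ : ℝ) < s - u i := fun i =>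
      lt_of_le_of_ne (Int.floor_le _) (hint i _).symm
    have hb : ∀ i, s - u i < ⌊s - u i⌋ + 1 := fun i => Int.lt_floor_add_one _
    -- Otherwise `s'` only has to lie in the open unit intervals starting at `w i + ⌊s - u i⌋`.
    -- Their intersection runs from the largest left end to the smallest right end.
    obtain ⟨i0, hi0⟩ := Finite.exists_max fun i => w i + ⌊s - u i⌋
    obtain ⟨j0, hj0⟩ := Finite.exists_min fun i => w i + ⌊s - u i⌋
    have hlt : w i0 + ⌊s - u i0⌋ < w j0 + ⌊s - u j0⌋ + 1 := by
      -- That the intersection is nonempty is a strict integer bound on a difference of entries, so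
      -- equality of integer parts carries it from `u` to `w`.
      have h1 : u i0 - u j0 < ((⌊s - u j0⌋ + 1 - ⌊s - u i0⌋ : ℤ) : ℝ) := by
        push_cast; linarith [ha i0, hb j0]
      rw [← Int.floor_lt, h, Int.floor_lt] at h1
      push_cast at h1
      linarith
    have hs : ∀ i, (⌊s - u i⌋ : ℝ) <
        (w i0 + ⌊s - u i0⌋ + (w j0 + ⌊s - u j0⌋ + 1)) / 2 - w i := fun i => by
      have := hi0 i; linarith
    have hs' : ∀ i, (w i0 + ⌊s - u i0⌋ + (w j0 + ⌊s - u j0⌋ + 1)) / 2 - w i <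
        ⌊s - u i⌋ + 1 := fun i => by
      have := hj0 i; linarith
    -- The midpoint of the intersection; halving costs the extra binary digit.
    refine ⟨(w i0 + ⌊s - u i0⌋ + (w j0 + ⌊s - u j0⌋ + 1)) / 2, fun i => ?_, fun i => ?_,
      fun k hk => ?_⟩
    · rw [(floor_eq_and_floor_neg_eq (hs i) (hs' i)).1]
    · have h1 := (floor_eq_and_floor_neg_eq (hs i) (hs' i)).2
      have h2 := (floor_eq_and_floor_neg_eq (ha i) (hb i)).2
      rw [neg_sub] at h1 h2
      rw [h1, h2]
    · obtain ⟨z, hz⟩ := hk i0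
      obtain ⟨z', hz'⟩ := hk j0
      refine ⟨z + z' + (⌊s - u i0⌋ + ⌊s - u j0⌋ + 1) * 2 ^ k, ?_⟩
      push_cast
      rw [← hz, ← hz']; ring

/-! ### The region equivalence -/

variable {S Q C : Type}

/-- The points in time that determine a configuration: the beginning, the current time, and the
times of the last resets of the clocks. -/
def Cfg.point (x : Cfg Q C) : Option (Option C) → ℝ
  | none => 0
  | some none => x.time
  | some (some c) => x.rst c

/-- The region of a configuration, where `D` is a common denominator of all time constants and `B`
exceeds all multiplicities. -/
noncomputable def Cfg.region (D B : ℕ) (x : Cfg Q C) :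
    Q × ℕ × ℕ × (Option (Option C) → Option (Option C) → ℤ) :=
  (x.loc, x.idx, min x.cnt B, fun i j => ⌊D * x.point i - D * x.point j⌋)

theorem Cfg.region_eq_iff {D B : ℕ} {x y : Cfg Q C} : x.region D B = y.region D B ↔
    x.loc = y.loc ∧ x.idx = y.idx ∧ min x.cnt B = min y.cnt B ∧
    ∀ i j, ⌊D * x.point i - D * x.point j⌋ = ⌊D * y.point i - D * y.point j⌋ := by
  simp only [Cfg.region, Prod.mk.injEq, funext_iff]

/-- All points of `x` are multiples of `1 / (D * 2 ^ k)`. -/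
def Cfg.OnGrid (D k : ℕ) (x : Cfg Q C) : Prop := ∀ i, ∃ z : ℤ, D * x.point i * 2 ^ k = z

theorem Cfg.OnGrid.mono {D k l : ℕ} {x : Cfg Q C} (h : x.OnGrid D k) (hkl : k ≤ l) :
    x.OnGrid D l := by
  intro i
  obtain ⟨z, hz⟩ := h i
  obtain ⟨m, rfl⟩ := Nat.exists_eq_add_of_le hkl
  refine ⟨z * 2 ^ m, ?_⟩
  push_cast
  rw [← hz]; ring

def Multiplicity.bound : Multiplicity → ℕ
  | .le e => e
  | .eq e => e
  | .ge e => e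

/-- `D` is a common denominator of the time constants of `o`, which are at most `M`, and `B`
exceeds the multiplicities of `o`. -/
structure Observation.Bounded (o : Observation S Q C) (D B M : ℕ) : Prop where
  pos : 0 < D
  lo : ∀ it ∈ o, it.interval.lo.den ∣ D
  hi : ∀ it ∈ o, it.interval.hi.den ∣ D
  mult : ∀ it ∈ o, it.mult.bound < B
  le : ∀ it ∈ o, it.interval.hi ≤ M

theorem Multiplicity.allows_congr {m : Multiplicity} {B k l : ℕ} (hB : m.bound < B)
    (h : min k B = min l B) : m.Allows k ↔ m.Allows l := by
  cases m <;> simp only [Multiplicity.Allows, Multiplicity.bound] at * <;> omega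

/-- `p` and `q` compare in the same way with all multiples of `1 / D`. -/
def SameOrder (D : ℕ) (p q : ℝ≥0) : Prop :=
  ∀ r : ℝ≥0, (∃ m : ℕ, D * r = m) → (p ≤ r ↔ q ≤ r) ∧ (r ≤ p ↔ r ≤ q)

/-- Against an integer `m`, the floor of `D * a` decides `m ≤ D * a`, and the floor of its negative
decides `D * a ≤ m`. -/
theorem sameOrder_toNNReal {D : ℕ} (hD : 0 < D) {a b : ℝ}
    (h1 : ⌊D * a⌋ = ⌊D * b⌋) (h2 : ⌊-(D * a)⌋ = ⌊-(D * b)⌋) :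
    SameOrder D a.toNNReal b.toNNReal := by
  rintro r ⟨m, hm⟩
  have hD' : (0 : ℝ) < D := by exact_mod_cast hD
  have hm' : (D : ℝ) * r = m := by
    have := congrArg NNReal.toReal hm
    push_cast at this
    exact this
  have key1 : ∀ c : ℝ, c ≤ r ↔ -(m : ℤ) ≤ ⌊-(D * c)⌋ := by
    intro c
    rw [Int.le_floor]
    push_cast
    rw [neg_le_neg_iff, ← hm', mul_le_mul_iff_right₀ hD']
  have key2 : ∀ c : ℝ, r ≤ c ↔ (m : ℤ) ≤ ⌊D * c⌋ := by
    intro c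
    rw [Int.le_floor]
    push_cast
    rw [← hm', mul_le_mul_iff_right₀ hD']
  constructor
  · rw [Real.toNNReal_le_iff_le_coe, Real.toNNReal_le_iff_le_coe, key1, key1, h2]
  -- For `r = 0` the comparison is trivial after truncation; for `r > 0` truncation does not affect
  -- it.
  · rcases eq_or_lt_of_le (zero_le (a := r)) with rfl | h0
    · simp
    · have h0' : (0 : ℝ) < r := h0
      rw [← Real.toNNReal_coe (r := r), Real.toNNReal_le_toNNReal_iff_of_pos h0',
        Real.toNNReal_le_toNNReal_iff_of_pos h0', key2, key2, h1]

theorem Cmp.holds_congr {D : ℕ} {p q : ℝ≥0} (h : SameOrder D p q) (m : Cmp) (k : ℕ) :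
    m.Holds p k ↔ m.Holds q k := by
  obtain ⟨h1, h2⟩ := h k ⟨D * k, by push_cast; rfl⟩
  cases m <;> simp only [Cmp.Holds]
  · rw [← not_le, ← not_le, h2]
  · exact h1
  · rw [le_antisymm_iff, le_antisymm_iff, h1, h2]
  · exact h2
  · rw [gt_iff_lt, gt_iff_lt, ← not_le, ← not_le, h1]

theorem ClockConstraint.sat_congr {D : ℕ} {v v' : C → ℝ≥0} (h : ∀ c, SameOrder D (v c) (v' c))
    (g : ClockConstraint C) : g.Sat v ↔ g.Sat v' :=
  forall₂_congr fun a _ => Cmp.holds_congr (h a.clock) a.cmp a.bound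

theorem Formula.sat_iff_of_sameOrder {D : ℕ} {v v' : C → ℝ≥0}
    (h : ∀ c, SameOrder D (v c) (v' c)) (a : S) (q : Q) (φ : Formula S Q C) :
    φ.Sat a q v ↔ φ.Sat a q v' := by
  induction φ with
  | letter => rfl
  | loc => rfl
  | constraint g => exact g.sat_congr h
  | neg φ ih => simp only [Formula.Sat, ih]
  | conj φ ψ ih1 ih2 => simp only [Formula.Sat, ih1, ih2]
  | disj φ ψ ih1 ih2 => simp only [Formula.Sat, ih1, ih2]

theorem exists_mul_cast_eq {D : ℕ} {r : ℚ≥0} (h : r.den ∣ D) :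
    ∃ m : ℕ, (D : ℝ≥0) * (r : ℝ≥0) = m := by
  obtain ⟨k, rfl⟩ := h
  refine ⟨k * r.num, ?_⟩
  have h0 : (r.den : ℝ≥0) ≠ 0 := by exact_mod_cast r.den_ne_zero
  rw [NNRat.cast_def]
  push_cast
  field_simp

theorem RatInterval.mem_toSet_congr {D : ℕ} {p q : ℝ≥0} (h : SameOrder D p q) {I : RatInterval}
    (hlo : I.lo.den ∣ D) (hhi : I.hi.den ∣ D) : p ∈ I.toSet ↔ q ∈ I.toSet := by
  obtain ⟨h1, h2⟩ := h _ (exists_mul_cast_eq hlo)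
  obtain ⟨h3, h4⟩ := h _ (exists_mul_cast_eq hhi)
  simp only [RatInterval.toSet, Set.mem_ofPred_eq, ← not_le (b := (I.lo : ℝ≥0)),
    ← not_le (a := (I.hi : ℝ≥0)), h1, h2, h3, h4]

/-- Which points move to the new time depends on `t` alone, so differences after the step reduce to
the same cases on both sides. -/
theorem Cfg.point_read_cases (x y : Cfg Q C) (t : Transition S Q C) (s s' : ℝ)
    (i : Option (Option C)) :
    ((x.read t s).point i = s ∧ (y.read t s').point i = s') ∨
      ∃ j, (x.read t s).point i = x.point j ∧ (y.read t s').point i = y.point j := by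
  classical
  match i with
  | none => exact Or.inr ⟨none, rfl, rfl⟩
  | some none => exact Or.inl ⟨rfl, rfl⟩
  | some (some c) =>
    by_cases hc : c ∈ t.reset
    · exact Or.inl ⟨if_pos hc, if_pos hc⟩
    · exact Or.inr ⟨some (some c), if_neg hc, if_neg hc⟩

theorem Cfg.point_advance (x : Cfg Q C) (i : Option (Option C)) :
    x.advance.point i = x.point i := by
  match i with
  | none | some none | some (some c) => rfl

/-- Configurations in the same region have steps to the same regions. -/
theorem Step.lift [Finite C] {A : TBA S Q C} {o : Observation S Q C} {D B M : ℕ}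
    (ho : o.Bounded D B M) {x y x' : Cfg Q C} (hxy : x.region D B = y.region D B)
    (h : Step A o x x') :
    ∃ y', Step A o y y' ∧ x'.region D B = y'.region D B ∧
      ∀ k, y.OnGrid D k → y'.OnGrid D (k + 1) := by
  obtain ⟨hloc, hidx, hcnt, hpt⟩ := Cfg.region_eq_iff.1 hxy
  have hD : (0 : ℝ) < D := by exact_mod_cast ho.pos
  cases h with
  | advance it hit hm =>
    refine ⟨y.advance, .advance y it (hidx ▸ hit) ?_, ?_, ?_⟩
    · exact (Multiplicity.allows_congr (ho.mult it (List.mem_of_getElem? hit)) hcnt).1 hm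
    · refine Cfg.region_eq_iff.2 ⟨hloc, congrArg (· + 1) hidx, rfl, fun i j => ?_⟩
      simp only [Cfg.point_advance, hpt]
    · intro k hk i
      rw [Cfg.point_advance]
      exact hk.mono (Nat.le_succ k) i
  | read it hit t ht hsrc s hs hg hf hi =>
    have hmem := List.mem_of_getElem? hit
    obtain ⟨u, hu1, hu2, hu3⟩ := exists_floor_sub_eq _ _ hpt (D * s)
    obtain ⟨s', rfl⟩ : ∃ s', u = D * s' := ⟨u / D, by field_simp⟩
    have hpt' : ∀ i j, ⌊D * (x.read t s).point i - D * (x.read t s).point j⌋ =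
        ⌊D * (y.read t s').point i - D * (y.read t s').point j⌋ := by
      intro i j
      rcases Cfg.point_read_cases x y t s s' i with ⟨h1, h2⟩ | ⟨i', h1, h2⟩ <;>
      rcases Cfg.point_read_cases x y t s s' j with ⟨h3, h4⟩ | ⟨j', h3, h4⟩ <;>
      rw [h1, h2, h3, h4]
      · simp
      · exact hu1 j'
      · exact hu2 i'
      · exact hpt i' j'
    have hsame : ∀ i, SameOrder D (s - x.point i).toNNReal (s' - y.point i).toNNReal := by
      intro i
      refine sameOrder_toNNReal ho.pos ?_ ?_
      · rw [mul_sub, mul_sub]; exact hu1 i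
      · rw [mul_sub, mul_sub, neg_sub, neg_sub]; exact hu2 i
    have hsame' : ∀ c, SameOrder D ((x.read t s).val c) ((y.read t s').val c) := by
      intro c
      refine sameOrder_toNNReal ho.pos ?_ ?_
      · rw [mul_sub, mul_sub]; exact hpt' (some none) (some (some c))
      · rw [mul_sub, mul_sub, neg_sub, neg_sub]; exact hpt' (some (some c)) (some none)
    refine ⟨y.read t s', .read y it (hidx ▸ hit) t ht (hsrc.trans hloc) s' ?_ ?_ ?_ ?_, ?_, ?_⟩
    · have h1 : 0 ≤ ⌊D * s - D * x.point (some none)⌋ := by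
        rw [Int.floor_nonneg, ← mul_sub]
        exact mul_nonneg hD.le (sub_nonneg.2 hs)
      rw [hu1, Int.floor_nonneg, ← mul_sub] at h1
      exact sub_nonneg.1 (nonneg_of_mul_nonneg_right h1 hD)
    · exact (ClockConstraint.sat_congr (fun c => hsame (some (some c))) _).1 hg
    · exact (Formula.sat_iff_of_sameOrder hsame' _ _ _).1 hf
    -- The point `none` is the origin, so absolute time behaves like a clock that is never reset.
    · have := hsame none
      simp only [Cfg.point, sub_zero] at this
      exact (RatInterval.mem_toSet_congr this (ho.lo it hmem) (ho.hi it hmem)).1 hi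
    · refine Cfg.region_eq_iff.2 ⟨rfl, hidx, ?_, hpt'⟩
      simp only [Cfg.read]
      omega
    · intro k hk i
      rcases Cfg.point_read_cases x y t s s' i with ⟨-, h2⟩ | ⟨i', -, h2⟩ <;> rw [h2]
      · exact hu3 k hk
      · exact hk.mono (Nat.le_succ k) i'

/-! ### Finiteness of the set of regions -/

/-- The configurations that occur in runs have bounded entries. -/
structure Cfg.Valid (M l : ℕ) (x : Cfg Q C) : Prop where
  idx : x.idx ≤ l
  rst_nonneg : ∀ c, 0 ≤ x.rst c
  rst_le : ∀ c, x.rst c ≤ x.time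
  time_nonneg : 0 ≤ x.time
  time_le : x.time ≤ M

theorem Cfg.valid_start (M l : ℕ) (q : Q) : (Cfg.start q : Cfg Q C).Valid M l :=
  ⟨Nat.zero_le _, fun _ => le_rfl, fun _ => le_rfl, le_rfl, Nat.cast_nonneg _⟩

theorem RatInterval.le_of_mem {I : RatInterval} {M : ℕ} (hM : I.hi ≤ M) {s : ℝ}
    (h : s.toNNReal ∈ I.toSet) : s ≤ M := by
  have h1 : s.toNNReal ≤ (I.hi : ℝ≥0) := by
    have := h.2
    split_ifs at this
    exacts [this, this.le]
  have h2 : (I.hi : ℝ≥0) ≤ M := by exact_mod_cast hM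
  exact_mod_cast Real.toNNReal_le_iff_le_coe.1 (h1.trans h2)

theorem Step.valid {A : TBA S Q C} {o : Observation S Q C} {D B M : ℕ}
    (ho : o.Bounded D B M) {x y : Cfg Q C} (hx : x.Valid M o.length) (h : Step A o x y) :
    y.Valid M o.length := by
  cases h with
  | advance it hit hm =>
    exact ⟨(List.getElem?_eq_some_iff.1 hit).1, hx.rst_nonneg, hx.rst_le, hx.time_nonneg,
      hx.time_le⟩
  | read it hit t ht hsrc s hs hg hf hi =>
    refine ⟨hx.idx, fun c => ?_, fun c => ?_, hx.time_nonneg.trans hs,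
      RatInterval.le_of_mem (ho.le it (List.mem_of_getElem? hit)) hi⟩ <;>
    simp only [Cfg.read] <;> split_ifs
    · exact hx.time_nonneg.trans hs
    · exact hx.rst_nonneg c
    · exact le_rfl
    · exact (hx.rst_le c).trans hs

open Classical in
/-- The finitely many regions of valid configurations. -/
noncomputable def regions [Fintype Q] [Fintype C] (D B M l : ℕ) :
    Finset (Q × ℕ × ℕ × (Option (Option C) → Option (Option C) → ℤ)) :=
  Finset.univ ×ˢ Finset.range (l + 1) ×ˢ Finset.range (B + 1) ×ˢ
    Fintype.piFinset fun _ => Fintype.piFinset fun _ => Finset.Icc (-(D * M : ℤ)) (D * M)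

theorem card_regions [Fintype Q] [Fintype C] (D B M l : ℕ) :
    (regions D B M l : Finset (Q × ℕ × ℕ × (Option (Option C) → Option (Option C) → ℤ))).card =
      Fintype.card Q * ((l + 1) * ((B + 1) *
        ((2 * (D * M) + 1) ^ (Fintype.card C + 2)) ^ (Fintype.card C + 2))) := by
  simp only [regions, Finset.card_product, Finset.card_univ, Finset.card_range,
    Fintype.card_piFinset, Int.card_Icc, Finset.prod_const, Fintype.card_option]
  congr 5
  norm_cast
  omega

/-- All points lie between 0 and `M`, so scaled differences lie between `-(D * M)` and `D * M`. -/
theorem Cfg.Valid.region_mem [Fintype Q] [Fintype C] {x : Cfg Q C} {M l : ℕ} (hx : x.Valid M l)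
    (D B : ℕ) : x.region D B ∈ regions D B M l := by
  have hD : (0 : ℝ) ≤ D := Nat.cast_nonneg _
  have h0 : ∀ i, 0 ≤ x.point i := by
    intro i
    match i with
    | none => exact le_rfl
    | some none => exact hx.time_nonneg
    | some (some c) => exact hx.rst_nonneg c
  have h1 : ∀ i, x.point i ≤ M := by
    intro i
    match i with
    | none => exact Nat.cast_nonneg _
    | some none => exact hx.time_le
    | some (some c) => exact (hx.rst_le c).trans hx.time_le
  simp only [regions, Cfg.region, Finset.mem_product, Finset.mem_univ, Finset.mem_range,
    Fintype.mem_piFinset, Finset.mem_Icc, true_and]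
  refine ⟨Nat.lt_succ_of_le hx.idx, Nat.lt_succ_of_le (min_le_right _ _), fun i j => ⟨?_, ?_⟩⟩
  · rw [Int.le_floor]
    push_cast
    nlinarith [mul_nonneg hD (h0 i), mul_le_mul_of_nonneg_left (h1 j) hD]
  · have : ((⌊D * x.point i - D * x.point j⌋ : ℤ) : ℝ) ≤ (D * M : ℤ) := by
      refine (Int.floor_le _).trans ?_
      push_cast
      nlinarith [mul_nonneg hD (h0 j), mul_le_mul_of_nonneg_left (h1 i) hD]
    exact_mod_cast this

/-! ### Short paths on a grid -/

theorem Cfg.onGrid_start (D : ℕ) (q : Q) : (Cfg.start q : Cfg Q C).OnGrid D 0 := by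
  intro i
  refine ⟨0, ?_⟩
  match i with
  | none | some none | some (some c) => simp [Cfg.point, Cfg.start]

/-- Each lifted step refines the grid by one binary digit, so after `n` steps from depth `k`
everything still lies on the common grid of depth `N`. -/
theorem ReachIn.lift_onGrid [Finite C] {A : TBA S Q C} {o : Observation S Q C} {D B M : ℕ}
    (ho : o.Bounded D B M) {N k n : ℕ} (hN : k + n ≤ N) {x y z : Cfg Q C}
    (hxy : x.region D B = y.region D B) (hy : y.OnGrid D k) (h : ReachIn (Step A o) n x z) :
    ∃ z', ReachIn (fun a b => Step A o a b ∧ b.OnGrid D N) n y z' ∧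
      z.region D B = z'.region D B := by
  induction n generalizing x y k with
  | zero => obtain rfl : x = z := h; exact ⟨y, rfl, hxy⟩
  | succ n ih =>
    obtain ⟨u, h1, h2⟩ := h
    obtain ⟨u', h3, h4, h5⟩ := h1.lift ho hxy
    obtain ⟨z', h6, h7⟩ := ih (k := k + 1) (by omega) h4 (h5 k hy) h2
    exact ⟨z', ⟨u', ⟨h3, (h5 k hy).mono (by omega)⟩, h6⟩, h7⟩

/-- If the end of the observation can be reached, then this is possible with few steps and with
times on a grid. -/
theorem exists_reachIn_onGrid [Fintype Q] [Fintype C] {A : TBA S Q C} {o : Observation S Q C}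
    {D B M N : ℕ} (ho : o.Bounded D B M)
    (hN : Fintype.card Q * ((o.length + 1) * ((B + 1) *
        ((2 * (D * M) + 1) ^ (Fintype.card C + 2)) ^ (Fintype.card C + 2))) ≤ N)
    {q : Q} {x : Cfg Q C} (h : Relation.ReflTransGen (Step A o) (Cfg.start q) x)
    (hx : x.idx = o.length) :
    ∃ n ≤ N, ∃ z, ReachIn (fun a b => Step A o a b ∧ b.OnGrid D N) n (Cfg.start q) z ∧
      z.idx = o.length := by
  obtain ⟨n, hn⟩ := exists_reachIn_of_reflTransGen h
  obtain ⟨m, hm, z, hz, hzi⟩ := hn.exists_lt_card (abs := Cfg.region D B)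
    (fun x y x' hxy hs => by
      obtain ⟨y', h1, h2, -⟩ := hs.lift ho hxy
      exact ⟨y', h1, h2⟩)
    (I := Cfg.Valid M o.length) (fun x y hx hs => hs.valid ho hx) (regions D B M o.length)
    (fun x hx => hx.region_mem D B) (G := fun x => x.idx = o.length)
    (fun x y hxy hx => (Cfg.region_eq_iff.1 hxy).2.1 ▸ hx) (Cfg.valid_start M _ q) hx
  rw [card_regions] at hm
  obtain ⟨z', h1, h2⟩ := hz.lift_onGrid ho (N := N) (k := 0) (by omega) rfl
    (Cfg.onGrid_start D q)
  exact ⟨m, by omega, z', h1, (Cfg.region_eq_iff.1 h2).2.1 ▸ hzi⟩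

/-! ### Primitive recursive functions -/

-- With these closure rules, primitive recursiveness of each part of the algorithm follows from the
-- syntax of its definition.
attribute [fun_prop] Primrec
attribute [fun_prop] Primrec.id Primrec.const Primrec.comp Primrec.pair Primrec.fst Primrec.snd

section Primrec

variable {α β γ : Type*} [Primcodable α] [Primcodable β] [Primcodable γ]

@[fun_prop]
theorem primrec_add {f g : α → ℕ} (hf : Primrec f) (hg : Primrec g) :
    Primrec fun a => f a + g a := Primrec.nat_add.comp hf hg

@[fun_prop]
theorem primrec_mul {f g : α → ℕ} (hf : Primrec f) (hg : Primrec g) :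
    Primrec fun a => f a * g a := Primrec.nat_mul.comp hf hg

@[fun_prop]
theorem primrec_sub {f g : α → ℕ} (hf : Primrec f) (hg : Primrec g) :
    Primrec fun a => f a - g a := Primrec.nat_sub.comp hf hg

@[fun_prop]
theorem primrec_pow {f g : α → ℕ} (hf : Primrec f) (hg : Primrec g) :
    Primrec fun a => f a ^ g a :=
  (Primrec₂.unpaired'.1 Nat.Primrec.pow).comp hf hg

@[fun_prop]
theorem primrec_factorial {f : α → ℕ} (hf : Primrec f) : Primrec fun a => (f a).factorial := by
  have h : Primrec₂ fun n m : ℕ => (n + 1) * m := by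
    unfold Primrec₂; fun_prop
  have : Primrec Nat.factorial := (Primrec.nat_rec₁ 1 h).of_eq fun n => by
    induction n with
    | zero => rfl
    | succ n ih => rw [Nat.factorial_succ, ← ih]
  exact this.comp hf

@[fun_prop]
theorem primrec_bool_and {f g : α → Bool} (hf : Primrec f) (hg : Primrec g) :
    Primrec fun a => f a && g a := Primrec.and.comp hf hg

@[fun_prop]
theorem primrec_bool_or {f g : α → Bool} (hf : Primrec f) (hg : Primrec g) :
    Primrec fun a => f a || g a := Primrec.or.comp hf hg

@[fun_prop]
theorem primrec_bool_not {f : α → Bool} (hf : Primrec f) : Primrec fun a => !f a :=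
  Primrec.not.comp hf

@[fun_prop]
theorem primrec_decide_le {f g : α → ℕ} (hf : Primrec f) (hg : Primrec g) :
    Primrec fun a => decide (f a ≤ g a) := Primrec.nat_le.decide.comp hf hg

@[fun_prop]
theorem primrec_decide_lt {f g : α → ℕ} (hf : Primrec f) (hg : Primrec g) :
    Primrec fun a => decide (f a < g a) := Primrec.nat_lt.decide.comp hf hg

@[fun_prop]
theorem primrec_decide_eq {f g : α → ℕ} (hf : Primrec f) (hg : Primrec g) :
    Primrec fun a => decide (f a = g a) := Primrec.eq.decide.comp hf hg

@[fun_prop]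
theorem primrec_bool_cond {c : α → Bool} {f g : α → β} (hc : Primrec c) (hf : Primrec f)
    (hg : Primrec g) : Primrec fun a => bif c a then f a else g a := Primrec.cond hc hf hg

@[fun_prop]
theorem primrec_cons {f : α → β} {g : α → List β} (hf : Primrec f) (hg : Primrec g) :
    Primrec fun a => f a :: g a := Primrec.list_cons.comp hf hg

@[fun_prop]
theorem primrec_append {f g : α → List β} (hf : Primrec f) (hg : Primrec g) :
    Primrec fun a => f a ++ g a := Primrec.list_append.comp hf hg

@[fun_prop]
theorem primrec_headI [Inhabited β] {f : α → List β} (hf : Primrec f) :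
    Primrec fun a => (f a).headI := Primrec.list_headI.comp hf

@[fun_prop]
theorem primrec_tail {f : α → List β} (hf : Primrec f) :
    Primrec fun a => (f a).tail := Primrec.list_tail.comp hf

@[fun_prop]
theorem primrec_range {f : α → ℕ} (hf : Primrec f) :
    Primrec fun a => List.range (f a) := Primrec.list_range.comp hf

@[fun_prop]
theorem primrec_getD {f : α → List β} {g : α → ℕ} (d : β) (hf : Primrec f) (hg : Primrec g) :
    Primrec fun a => (f a).getD (g a) d := (Primrec.list_getD d).comp hf hg

@[fun_prop]
theorem primrec_getElem?_toList {f : α → List β} {g : α → ℕ} (hf : Primrec f) (hg : Primrec g) :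
    Primrec fun a => ((f a)[g a]?).toList :=
  Primrec.optionToList.comp (Primrec.list_getElem?.comp hf hg)

@[fun_prop]
theorem primrec_length {f : α → List β} (hf : Primrec f) :
    Primrec fun a => (f a).length := Primrec.list_length.comp hf

@[fun_prop]
theorem primrec_map {f : α → List β} {g : α → β → γ} (hf : Primrec f)
    (hg : Primrec fun p : α × β => g p.1 p.2) : Primrec fun a => (f a).map (g a) :=
  Primrec.list_map hf hg

@[fun_prop]
theorem primrec_flatMap {f : α → List β} {g : α → β → List γ} (hf : Primrec f)
    (hg : Primrec fun p : α × β => g p.1 p.2) : Primrec fun a => (f a).flatMap (g a) :=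
  Primrec.list_flatMap hf hg

@[fun_prop]
theorem primrec_foldr {f : α → List β} {g : α → γ} {h : α → β → γ → γ} (hf : Primrec f)
    (hg : Primrec g) (hh : Primrec fun p : α × β × γ => h p.1 p.2.1 p.2.2) :
    Primrec fun a => (f a).foldr (h a) (g a) :=
  Primrec.list_foldr (h := fun a p => h a p.1 p.2) hf hg hh

@[fun_prop]
theorem primrec_all {f : α → List β} {g : α → β → Bool} (hf : Primrec f)
    (hg : Primrec fun p : α × β => g p.1 p.2) : Primrec fun a => (f a).all (g a) := by
  have : Primrec fun a => (f a).foldr (fun b r => g a b && r) true := by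
    have : Primrec fun p : α × β × Bool => g p.1 p.2.1 :=
      hg.comp (Primrec.fst.pair (Primrec.fst.comp Primrec.snd))
    fun_prop
  refine this.of_eq fun a => ?_
  induction f a with
  | nil => rfl
  | cons b l ih => rw [List.foldr_cons, ih, List.all_cons]

@[fun_prop]
theorem primrec_any {f : α → List β} {g : α → β → Bool} (hf : Primrec f)
    (hg : Primrec fun p : α × β => g p.1 p.2) : Primrec fun a => (f a).any (g a) := by
  have : Primrec fun a => !(f a).all fun b => !g a b := by fun_prop
  exact this.of_eq fun a => by rw [List.not_all_eq_any_not]; simp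

@[fun_prop]
theorem primrec_iterate {f : α → ℕ} {g : α → β} {h : α → β → β} (hf : Primrec f)
    (hg : Primrec g) (hh : Primrec fun p : α × β => h p.1 p.2) :
    Primrec fun a => (h a)^[f a] (g a) := Primrec.nat_iterate hf hg hh

end Primrec

/-! ### The algorithm

Times are represented by natural numbers: `t` stands for `t / K`, where `K` is a parameter. -/

/-- The comparison with code `m`. -/
def cmpTest (m n k : ℕ) : Bool :=
  (decide (m = 0) && decide (n < k)) || (decide (m = 1) && decide (n ≤ k)) ||
  (decide (m = 2) && decide (n = k)) || (decide (m = 3) && decide (k ≤ n)) ||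
  (decide (m = 4) && decide (k < n))

/-- Test of a clock constraint at time `t`, where the clocks have been reset at the times `r`. -/
def constraintTest (K t : ℕ) (r : List ℕ) (g : ConstraintCode) : Bool :=
  g.all fun a => cmpTest a.2.1 (t - r.getD a.1 0) (a.2.2 * K)

/-- Process one symbol of a formula, read from right to left, with a stack of truth values. -/
def symbolStep (K a q t : ℕ) (r : List ℕ) (s : ℕ × ℕ × ConstraintCode) (st : List Bool) :
    List Bool :=
  bif decide (s.1 = 0) then decide (s.2.1 = a) :: st else
  bif decide (s.1 = 1) then decide (s.2.1 = q) :: st else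
  bif decide (s.1 = 2) then constraintTest K t r s.2.2 :: st else
  bif decide (s.1 = 3) then (!st.headI) :: st.tail else
  bif decide (s.1 = 4) then (st.headI && st.tail.headI) :: st.tail.tail else
  (st.headI || st.tail.headI) :: st.tail.tail

/-- Test of a formula. -/
def formulaTest (K a q t : ℕ) (r : List ℕ) (φ : FormulaCode) : Bool :=
  (φ.foldr (symbolStep K a q t r) []).headI

/-- Test of the membership in an interval. -/
def intervalTest (K t : ℕ) (I : IntervalCode) : Bool :=
  (bif I.2.2.1 then decide (I.1.1 * K ≤ t * I.1.2) else decide (I.1.1 * K < t * I.1.2)) &&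
  (bif I.2.2.2 then decide (t * I.2.1.2 ≤ I.2.1.1 * K) else decide (t * I.2.1.2 < I.2.1.1 * K))

/-- Test of a multiplicity. -/
def multTest (m : ℕ × ℕ) (k : ℕ) : Bool :=
  (decide (m.1 = 0) && decide (k ≤ m.2)) || (decide (m.1 = 1) && decide (k = m.2)) ||
  (decide (m.1 = 2) && decide (m.2 ≤ k))

/-- Location, time, times of the last resets, position in the observation, number of letters read
at this position. -/
abbrev CfgCode := ℕ × ℕ × List ℕ × ℕ × ℕ

/-- The configuration after taking the transition `t` at time `s`. -/
def readCode (c : ℕ) (x : CfgCode) (t : TransitionCode) (s : ℕ) : CfgCode :=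
  (t.2.1, s, (List.range c).map fun j =>
    bif t.2.2.2.1.any fun i => decide (i = j) then s else x.2.2.1.getD j 0,
    x.2.2.2.1, x.2.2.2.2 + 1)

/-- Test whether the transition `t` can be taken at time `s`. -/
def readTest (K c : ℕ) (it : ItemCode) (x : CfgCode) (t : TransitionCode) (s : ℕ) : Bool :=
  decide (t.1 = x.1) && decide (x.2.1 ≤ s) && constraintTest K s x.2.2.1 t.2.2.2.2 &&
  formulaTest K t.2.2.1 t.2.1 s (readCode c x t s).2.2.1 it.1 && intervalTest K s it.2.1

/-- The list of successors of a configuration whose times are at most `T`. -/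
def succs (K T : ℕ) (P : InstanceCode) (x : CfgCode) : List CfgCode :=
  (P.2.2[x.2.2.2.1]?).toList.flatMap fun it =>
    (bif multTest it.2.2 x.2.2.2.2 then [(x.1, x.2.1, x.2.2.1, x.2.2.2.1 + 1, 0)] else []) ++
    P.2.1.2.1.flatMap fun t => (List.range (T + 1)).flatMap fun s =>
      bif readTest K P.1.2.2 it x t s then [readCode P.1.2.2 x t s] else []

/-- The initial configurations. -/
def starts (P : InstanceCode) : List CfgCode :=
  P.2.1.1.map fun q => (q, 0, (List.range P.1.2.2).map fun _ => 0, 0, 0)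

/-- Whether the end of the observation is reached within `N` steps. -/
def search (K T N : ℕ) (P : InstanceCode) : Bool :=
  ((fun L => L ++ L.flatMap (succs K T P))^[N] (starts P)).any fun x =>
    decide (x.2.2.2.1 = P.2.2.length)

/-- A bound on the number of steps in terms of a bound on the size of the instance. -/
def stepBound (E : ℕ) : ℕ :=
  -- This is the number of regions with locations, clocks and positions bounded by `E`, and `D =
  -- E!`, `M = E`, `B = E + 1`; the first `E + 2` is `B + 1`, and the exponents count the clocks and
  -- the two extra points.
  E * ((E + 1) * ((E + 2) * ((2 * (E.factorial * E) + 1) ^ (E + 2)) ^ (E + 2)))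

/-- The decision procedure. -/
def decideNonempty (P : InstanceCode) : Bool :=
  -- The three numerical arguments are the grid scale `D * 2 ^ N`, the latest time `M` on this
  -- scale, and `N`.
  search ((Encodable.encode P).factorial * 2 ^ stepBound (Encodable.encode P))
    ((Encodable.encode P).factorial * 2 ^ stepBound (Encodable.encode P) * Encodable.encode P)
    (stepBound (Encodable.encode P)) P

section Primrec

variable {α : Type*} [Primcodable α]

@[fun_prop]
theorem primrec_cmpTest {m n k : α → ℕ} (hm : Primrec m) (hn : Primrec n) (hk : Primrec k) :
    Primrec fun a => cmpTest (m a) (n a) (k a) := by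
  unfold cmpTest; fun_prop

@[fun_prop]
theorem primrec_constraintTest {K t : α → ℕ} {r : α → List ℕ} {g : α → ConstraintCode}
    (hK : Primrec K) (ht : Primrec t) (hr : Primrec r) (hg : Primrec g) :
    Primrec fun a => constraintTest (K a) (t a) (r a) (g a) := by
  unfold constraintTest; fun_prop

@[fun_prop]
theorem primrec_symbolStep {K b q t : α → ℕ} {r : α → List ℕ} {s : α → ℕ × ℕ × ConstraintCode}
    {st : α → List Bool} (hK : Primrec K) (hb : Primrec b) (hq : Primrec q) (ht : Primrec t)
    (hr : Primrec r) (hs : Primrec s) (hst : Primrec st) :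
    Primrec fun a => symbolStep (K a) (b a) (q a) (t a) (r a) (s a) (st a) := by
  unfold symbolStep; fun_prop

@[fun_prop]
theorem primrec_formulaTest {K b q t : α → ℕ} {r : α → List ℕ} {φ : α → FormulaCode}
    (hK : Primrec K) (hb : Primrec b) (hq : Primrec q) (ht : Primrec t) (hr : Primrec r)
    (hφ : Primrec φ) : Primrec fun a => formulaTest (K a) (b a) (q a) (t a) (r a) (φ a) := by
  unfold formulaTest; fun_prop

@[fun_prop]
theorem primrec_intervalTest {K t : α → ℕ} {I : α → IntervalCode} (hK : Primrec K)
    (ht : Primrec t) (hI : Primrec I) : Primrec fun a => intervalTest (K a) (t a) (I a) := by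
  unfold intervalTest; fun_prop

@[fun_prop]
theorem primrec_multTest {m : α → ℕ × ℕ} {k : α → ℕ} (hm : Primrec m) (hk : Primrec k) :
    Primrec fun a => multTest (m a) (k a) := by
  unfold multTest; fun_prop

@[fun_prop]
theorem primrec_readCode {c s : α → ℕ} {x : α → CfgCode} {t : α → TransitionCode}
    (hc : Primrec c) (hx : Primrec x) (ht : Primrec t) (hs : Primrec s) :
    Primrec fun a => readCode (c a) (x a) (t a) (s a) := by
  unfold readCode; fun_prop

@[fun_prop]
theorem primrec_readTest {K c s : α → ℕ} {it : α → ItemCode} {x : α → CfgCode}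
    {t : α → TransitionCode} (hK : Primrec K) (hc : Primrec c) (hit : Primrec it)
    (hx : Primrec x) (ht : Primrec t) (hs : Primrec s) :
    Primrec fun a => readTest (K a) (c a) (it a) (x a) (t a) (s a) := by
  unfold readTest; fun_prop

@[fun_prop]
theorem primrec_succs {K T : α → ℕ} {P : α → InstanceCode} {x : α → CfgCode} (hK : Primrec K)
    (hT : Primrec T) (hP : Primrec P) (hx : Primrec x) :
    Primrec fun a => succs (K a) (T a) (P a) (x a) := by
  unfold succs; fun_prop

@[fun_prop]
theorem primrec_starts {P : α → InstanceCode} (hP : Primrec P) :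
    Primrec fun a => starts (P a) := by
  unfold starts; fun_prop

@[fun_prop]
theorem primrec_search {K T N : α → ℕ} {P : α → InstanceCode} (hK : Primrec K)
    (hT : Primrec T) (hN : Primrec N) (hP : Primrec P) :
    Primrec fun a => search (K a) (T a) (N a) (P a) := by
  unfold search; fun_prop

@[fun_prop]
theorem primrec_stepBound {E : α → ℕ} (hE : Primrec E) : Primrec fun a => stepBound (E a) := by
  unfold stepBound; fun_prop

theorem primrec_decideNonempty : Primrec decideNonempty := by
  have := Primrec.encode (α := InstanceCode)
  unfold decideNonempty; fun_prop

end Primrec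

/-! ### Correctness of the tests -/

theorem cmpTest_iff {K : ℕ} (hK : 0 < K) {p : ℝ≥0} {n : ℕ} (hp : p * K = n) (m : Cmp) (k : ℕ) :
    cmpTest m.code n (k * K) = true ↔ m.Holds p k := by
  have hK' : (0 : ℝ≥0) < K := by exact_mod_cast hK
  have h1 : p ≤ k ↔ n ≤ k * K := by
    rw [← mul_le_mul_iff_left₀ hK', hp]; norm_cast
  have h2 : (k : ℝ≥0) ≤ p ↔ k * K ≤ n := by
    rw [← mul_le_mul_iff_left₀ hK', hp]; norm_cast
  simp only [cmpTest, Bool.or_eq_true, Bool.and_eq_true, decide_eq_true_eq]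
  have h3 : p < k ↔ n < k * K := by rw [← not_le, h2, not_le]
  have h4 : (k : ℝ≥0) < p ↔ k * K < n := by rw [← not_le, h1, not_le]
  have h5 : p = k ↔ n = k * K := by rw [le_antisymm_iff, h1, h2, ← le_antisymm_iff]
  cases m <;> simp [Cmp.code, Cmp.Holds, h1, h2, h3, h4, h5]

theorem constraintTest_iff {c K : ℕ} (hK : 0 < K) {v : Fin c → ℝ≥0} {t : ℕ} {r : List ℕ}
    (hv : ∀ i : Fin c, v i * K = (t - r.getD i 0 : ℕ)) (g : ClockConstraint (Fin c)) :
    constraintTest K t r (codeConstraint g) = true ↔ g.Sat v := by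
  simp only [constraintTest, codeConstraint, ClockConstraint.Sat, List.all_map, List.all_eq_true]
  exact forall₂_congr fun a _ => cmpTest_iff hK (hv a.clock) a.cmp a.bound

-- Read from the right, prefix notation needs no parser: operands are evaluated before their
-- connective. The arbitrary stack `st` below makes the induction go through, as the second
-- operand's value waits there while the first is evaluated.
open Classical in
theorem foldr_symbolStep {l n c K : ℕ} (hK : 0 < K) {v : Fin c → ℝ≥0} {t : ℕ} {r : List ℕ}
    (hv : ∀ i : Fin c, v i * K = (t - r.getD i 0 : ℕ)) (a : Fin l) (q : Fin n)
    (φ : Formula (Fin l) (Fin n) (Fin c)) (st : List Bool) :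
    φ.code.foldr (symbolStep K a q t r) st = decide (φ.Sat a q v) :: st := by
  induction φ generalizing st with
  | letter a' => simp [Formula.code, symbolStep, Formula.Sat, Fin.ext_iff]
  | loc q' => simp [Formula.code, symbolStep, Formula.Sat, Fin.ext_iff]
  | constraint g =>
    simp only [Formula.code, symbolStep, Formula.Sat, List.foldr_cons, List.foldr_nil,
      ← constraintTest_iff hK hv]
    simp
  | neg φ ih =>
    have e : decide (φ.neg.Sat a q v) = !decide (φ.Sat a q v) := by
      rw [← decide_not]; exact decide_eq_decide.2 Iff.rfl
    simp [Formula.code, symbolStep, ih, e]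
  | conj φ ψ ih1 ih2 =>
    have e : decide ((φ.conj ψ).Sat a q v) = (decide (φ.Sat a q v) && decide (ψ.Sat a q v)) := by
      rw [← Bool.decide_and]; exact decide_eq_decide.2 Iff.rfl
    simp [Formula.code, symbolStep, ih1, ih2, e]
  | disj φ ψ ih1 ih2 =>
    have e : decide ((φ.disj ψ).Sat a q v) = (decide (φ.Sat a q v) || decide (ψ.Sat a q v)) := by
      rw [← Bool.decide_or]; exact decide_eq_decide.2 Iff.rfl
    simp [Formula.code, symbolStep, ih1, ih2, e]

theorem formulaTest_iff {l n c K : ℕ} (hK : 0 < K) {v : Fin c → ℝ≥0} {t : ℕ} {r : List ℕ}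
    (hv : ∀ i : Fin c, v i * K = (t - r.getD i 0 : ℕ)) (a : Fin l) (q : Fin n)
    (φ : Formula (Fin l) (Fin n) (Fin c)) :
    formulaTest K a q t r φ.code = true ↔ φ.Sat a q v := by
  simp [formulaTest, foldr_symbolStep hK hv]

theorem cast_le_iff {K : ℕ} (hK : 0 < K) {p : ℝ≥0} {n : ℕ} (hp : p * K = n) (r : ℚ≥0) :
    ((r : ℝ≥0) ≤ p ↔ r.num * K ≤ n * r.den) ∧ (p ≤ r ↔ n * r.den ≤ r.num * K) := by
  have hK' : (0 : ℝ≥0) < K := by exact_mod_cast hK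
  have hd : (0 : ℝ≥0) < r.den := by exact_mod_cast r.den_pos
  have e1 : (r : ℝ≥0) * (K * r.den) = (r.num * K : ℕ) := by
    rw [NNRat.cast_def]; push_cast; field_simp
  have e2 : p * (K * r.den) = (n * r.den : ℕ) := by
    rw [← mul_assoc, hp]; push_cast; rfl
  constructor
  · rw [← mul_le_mul_iff_left₀ (mul_pos hK' hd), e1, e2, Nat.cast_le]
  · rw [← mul_le_mul_iff_left₀ (mul_pos hK' hd), e1, e2, Nat.cast_le]

theorem intervalTest_eq_true (K n : ℕ) (I : IntervalCode) : intervalTest K n I = true ↔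
    (if I.2.2.1 then I.1.1 * K ≤ n * I.1.2 else I.1.1 * K < n * I.1.2) ∧
    (if I.2.2.2 then n * I.2.1.2 ≤ I.2.1.1 * K else n * I.2.1.2 < I.2.1.1 * K) := by
  unfold intervalTest
  cases I.2.2.1 <;> cases I.2.2.2 <;> simp

theorem intervalTest_iff {K : ℕ} (hK : 0 < K) {p : ℝ≥0} {n : ℕ} (hp : p * K = n)
    (I : RatInterval) : intervalTest K n I.code = true ↔ p ∈ I.toSet := by
  obtain ⟨h1, h2⟩ := cast_le_iff hK hp I.lo
  obtain ⟨h3, h4⟩ := cast_le_iff hK hp I.hi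
  simp only [intervalTest_eq_true, RatInterval.code, RatInterval.toSet, Set.mem_ofPred_eq,
    ← not_le (a := p), ← not_le (b := p), h1, h2, h3, h4]
  simp only [not_le]

theorem multTest_iff (m : Multiplicity) (k : ℕ) : multTest m.code k = true ↔ m.Allows k := by
  simp only [multTest, Bool.or_eq_true, Bool.and_eq_true, decide_eq_true_eq]
  cases m <;> simp [Multiplicity.code, Multiplicity.Allows]

/-! ### Configurations and their codes -/

/-- `y` is a code of `x`. -/
structure Codes {n c : ℕ} (K : ℕ) (x : Cfg (Fin n) (Fin c)) (y : CfgCode) : Prop where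
  loc : y.1 = x.loc
  time : x.time * K = y.2.1
  rst : ∀ i : Fin c, x.rst i * K = y.2.2.1.getD i 0
  idx : y.2.2.2.1 = x.idx
  cnt : y.2.2.2.2 = x.cnt

section Codes

variable {l n c K : ℕ} {x : Cfg (Fin n) (Fin c)} {y : CfgCode}

/-- Truncation at zero happens on both sides at once, so no ordering of the two times is needed. -/
theorem toNNReal_sub_mul (hK : 0 < K) {s r : ℝ} {a b : ℕ} (hs : s * K = a) (hr : r * K = b) :
    (s - r).toNNReal * K = (a - b : ℕ) := by
  have hK' : (0 : ℝ) < K := by exact_mod_cast hK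
  have h : (s - r) * K = a - b := by rw [sub_mul, hs, hr]
  rcases le_total b a with hab | hab
  · have h0 : 0 ≤ s - r := nonneg_of_mul_nonneg_left
      (by rw [h]; exact sub_nonneg.2 (Nat.cast_le.2 hab)) hK'
    apply NNReal.eq
    rw [NNReal.coe_mul, Real.coe_toNNReal _ h0, NNReal.coe_natCast, NNReal.coe_natCast, h,
      Nat.cast_sub hab]
  · have h0 : s - r ≤ 0 := nonpos_of_mul_nonpos_left
      (by rw [h]; exact sub_nonpos.2 (Nat.cast_le.2 hab)) hK'
    rw [Real.toNNReal_of_nonpos h0, Nat.sub_eq_zero_of_le hab]; simp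

theorem Codes.advance (h : Codes K x y) :
    Codes K x.advance (y.1, y.2.1, y.2.2.1, y.2.2.2.1 + 1, 0) :=
  ⟨h.loc, h.time, h.rst, congrArg (· + 1) h.idx, rfl⟩

theorem Codes.read (h : Codes K x y) (t : Transition (Fin l) (Fin n) (Fin c)) {s : ℝ} {m : ℕ}
    (hs : s * K = m) : Codes K (x.read t s) (readCode c y t.code m) := by
  refine ⟨rfl, hs, fun i => ?_, h.idx, congrArg (· + 1) h.cnt⟩
  have hany : ((t.reset.map Fin.val).any fun j => decide (j = (i : ℕ))) =
      decide (i ∈ t.reset) := by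
    rw [Bool.eq_iff_iff]
    simp [← Fin.ext_iff]
  by_cases hi : i ∈ t.reset
  · simp [readCode, Cfg.read, Transition.code, hi, hs, -List.any_map, hany]
  · simp [readCode, Cfg.read, Transition.code, hi, h.rst, -List.any_map, hany]

theorem readTest_iff (hK : 0 < K) (h : Codes K x y) (t : Transition (Fin l) (Fin n) (Fin c))
    {s : ℝ} {m : ℕ} (hs : s * K = m) (it : ObsItem (Fin l) (Fin n) (Fin c)) :
    readTest K c it.code y t.code m = true ↔ t.src = x.loc ∧ x.time ≤ s ∧
      (t.guard.Sat fun i => (s - x.rst i).toNNReal) ∧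
      it.formula.Sat t.letter t.tgt (x.read t s).val ∧ s.toNNReal ∈ it.interval.toSet := by
  have hK' : (0 : ℝ) < K := by exact_mod_cast hK
  have h1 : t.code.1 = y.1 ↔ t.src = x.loc := by
    rw [h.loc, Fin.ext_iff]; rfl
  have h2 : y.2.1 ≤ m ↔ x.time ≤ s := by
    rw [← mul_le_mul_iff_left₀ hK', hs, h.time, Nat.cast_le]
  have h3 := constraintTest_iff hK (fun i => toNNReal_sub_mul hK hs (h.rst i)) t.guard
  have h4 := formulaTest_iff hK (fun i => toNNReal_sub_mul hK (h.read t hs).time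
    ((h.read t hs).rst i)) t.letter t.tgt it.formula
  -- Absolute time is treated as the time elapsed since 0.
  have h5 := intervalTest_iff hK (p := s.toNNReal) (n := m)
    (by simpa using toNNReal_sub_mul hK hs (r := 0) (b := 0) (by simp)) it.interval
  simp only [readTest, Bool.and_eq_true, decide_eq_true_eq, and_assoc]
  rw [h1, h2]
  exact and_congr_right' <| and_congr_right' <| and_congr h3 <| and_congr h4 h5

end Codes

theorem mem_cond_singleton {X : Type*} {b : Bool} {a a' : X} :
    a ∈ (bif b then [a'] else []) ↔ b = true ∧ a = a' := by
  cases b <;> simp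

theorem mem_succs {P : Instance} {K T : ℕ} {y y' : CfgCode} : y' ∈ succs K T P.code y ↔
    ∃ it, P.obs[y.2.2.2.1]? = some it ∧
      ((multTest it.mult.code y.2.2.2.2 = true ∧ y' = (y.1, y.2.1, y.2.2.1, y.2.2.2.1 + 1, 0)) ∨
      ∃ t ∈ P.aut.trans, ∃ s ≤ T, readTest K P.numClocks it.code y t.code s = true ∧
        y' = readCode P.numClocks y t.code s) := by
  simp only [succs, Instance.code, List.mem_flatMap, Option.mem_toList, List.getElem?_map,
    Option.map_eq_some_iff, List.mem_append, List.mem_range, List.mem_map, Nat.lt_succ_iff,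
    mem_cond_singleton]
  constructor
  · rintro ⟨_, ⟨it, hit, rfl⟩, h | ⟨_, ⟨t, ht, rfl⟩, h⟩⟩
    exacts [⟨it, hit, .inl h⟩, ⟨it, hit, .inr ⟨t, ht, h⟩⟩]
  · rintro ⟨it, hit, h | ⟨t, ht, h⟩⟩
    exacts [⟨_, ⟨it, hit, rfl⟩, .inl h⟩, ⟨_, ⟨it, hit, rfl⟩, .inr ⟨_, ⟨t, ht, rfl⟩, h⟩⟩]


/-! ### Correctness of the search -/

theorem succs_sound {P : Instance} {K T : ℕ} (hK : 0 < K)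
    {x : Cfg (Fin P.numLocs) (Fin P.numClocks)} {y y' : CfgCode} (h : Codes K x y)
    (hy : y' ∈ succs K T P.code y) :
    ∃ x', Step P.aut P.obs x x' ∧ Codes K x' y' := by
  obtain ⟨it, hit, ⟨hm, rfl⟩ | ⟨t, ht, m, -, hr, rfl⟩⟩ := mem_succs.1 hy
  · exact ⟨_, .advance x it (h.idx ▸ hit) (by rwa [h.cnt, multTest_iff] at hm), h.advance⟩
  · have hs : (m / K : ℝ) * K = m := by
      have : (K : ℝ) ≠ 0 := by exact_mod_cast hK.ne'
      field_simp
    obtain ⟨h1, h2, h3, h4, h5⟩ := (readTest_iff hK h t hs it).1 hr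
    exact ⟨_, .read x it (h.idx ▸ hit) t ht h1 _ h2 h3 h4 h5, h.read t hs⟩

/-- The grid condition makes the scaled reading time an integer, and the interval bounds it by `M`,
so it is among the times tried. -/
theorem succs_complete {P : Instance} {D B M N : ℕ} (ho : P.obs.Bounded D B M)
    {x x' : Cfg (Fin P.numLocs) (Fin P.numClocks)} {y : CfgCode} (h : Codes (D * 2 ^ N) x y)
    (hx : Step P.aut P.obs x x') (hg : x'.OnGrid D N) :
    ∃ y' ∈ succs (D * 2 ^ N) (D * 2 ^ N * M) P.code y, Codes (D * 2 ^ N) x' y' := by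
  have hK : 0 < D * 2 ^ N := Nat.mul_pos ho.pos (by positivity)
  have hK' : (0 : ℝ) < (D * 2 ^ N : ℕ) := by exact_mod_cast hK
  cases hx with
  | advance it hit hm =>
    exact ⟨_, mem_succs.2 ⟨it, h.idx ▸ hit, .inl ⟨by rwa [h.cnt, multTest_iff], rfl⟩⟩, h.advance⟩
  | read it hit t ht hsrc s hs hg' hf hi =>
    obtain ⟨z, hz⟩ := hg (some none)
    replace hz : s * (D * 2 ^ N : ℕ) = z := by
      rw [← hz]; push_cast; simp only [Cfg.point, Cfg.read]; ring
    have hx0 : 0 ≤ x.time := by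
      have : 0 ≤ x.time * (D * 2 ^ N : ℕ) := by rw [h.time]; positivity
      exact nonneg_of_mul_nonneg_left this hK'
    have hz0 : 0 ≤ z := by
      have : (0 : ℝ) ≤ z := hz ▸ mul_nonneg (hx0.trans hs) hK'.le
      exact_mod_cast this
    lift z to ℕ using hz0
    have hs' : s * (D * 2 ^ N : ℕ) = z := by rw [hz]; norm_cast
    have hle : s ≤ M := RatInterval.le_of_mem (ho.le it (List.mem_of_getElem? hit)) hi
    refine ⟨_, mem_succs.2 ⟨it, h.idx ▸ hit, .inr ⟨t, ht, z, ?_,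
      (readTest_iff hK h t hs' it).2 ⟨hsrc, hs, hg', hf, hi⟩, rfl⟩⟩, h.read t hs'⟩
    have : (z : ℝ) ≤ (D * 2 ^ N * M : ℕ) := by
      rw [← hs', mul_comm, Nat.cast_mul (D * 2 ^ N)]
      exact mul_le_mul_of_nonneg_left hle hK'.le
    exact_mod_cast this

/-- Each round keeps the old elements, so `N` rounds collect all paths of length at most `N`. The
induction absorbs the first step into the starting list. -/
theorem mem_iterate_flatMap {X : Type*} (f : X → List X) (L : List X) (N : ℕ) (y : X) :
    y ∈ (fun L => L ++ L.flatMap f)^[N] L ↔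
      ∃ m ≤ N, ∃ x ∈ L, ReachIn (fun a b => b ∈ f a) m x y := by
  induction N generalizing L with
  | zero =>
    simp [ReachIn]
  | succ N ih =>
    rw [Function.iterate_succ_apply, ih]
    constructor
    · rintro ⟨m, hm, x, hx, h⟩
      rcases List.mem_append.1 hx with hx | hx
      · exact ⟨m, by omega, x, hx, h⟩
      · obtain ⟨u, hu, hux⟩ := List.mem_flatMap.1 hx
        exact ⟨m + 1, by omega, u, hu, x, hux, h⟩
    · rintro ⟨m, hm, x, hx, h⟩
      cases m with
      | zero => exact ⟨0, Nat.zero_le _, x, List.mem_append_left _ hx, h⟩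
      | succ m =>
        obtain ⟨u, hu, h⟩ := h
        exact ⟨m, by omega, u, List.mem_append_right _ (List.mem_flatMap.2 ⟨x, hx, hu⟩), h⟩

theorem codes_start {n c : ℕ} (K : ℕ) (q : Fin n) :
    Codes (c := c) K (Cfg.start q) (q, 0, (List.range c).map fun _ => 0, 0, 0) := by
  refine ⟨rfl, by simp [Cfg.start], fun i => ?_, rfl, rfl⟩
  simp [Cfg.start]

theorem search_iff {P : Instance} {D B M N : ℕ} (ho : P.obs.Bounded D B M)
    (hN : P.numLocs * ((P.obs.length + 1) * ((B + 1) *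
        ((2 * (D * M) + 1) ^ (P.numClocks + 2)) ^ (P.numClocks + 2))) ≤ N) :
    search (D * 2 ^ N) (D * 2 ^ N * M) N P.code = true ↔
      (P.aut.consistentWords P.obs).Nonempty := by
  have hK : 0 < D * 2 ^ N := Nat.mul_pos ho.pos (by positivity)
  have hlen : P.code.2.2.length = P.obs.length := List.length_map ..
  have hstart : ∀ y, y ∈ starts P.code ↔ ∃ q ∈ P.aut.init,
      ((q : ℕ), 0, (List.range P.numClocks).map fun _ => 0, 0, 0) = y := by
    intro y
    simp [starts, Instance.code]
  rw [consistentWords_nonempty_iff]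
  simp only [search, List.any_eq_true, decide_eq_true_eq, mem_iterate_flatMap, hlen]
  constructor
  · rintro ⟨y, ⟨m, -, y0, hy0, hy⟩, hidx⟩
    obtain ⟨q, hq, rfl⟩ := (hstart _).1 hy0
    obtain ⟨x, hx, hxy⟩ := hy.simulate (R' := Step P.aut P.obs)
      (V := fun y x => Codes (D * 2 ^ N) x y)
      (fun y x y' h hs => succs_sound hK h hs) (codes_start _ q)
    exact ⟨q, hq, x, hx.reflTransGen, hxy.idx ▸ hidx⟩
  · rintro ⟨q, hq, x, hx, hidx⟩
    obtain ⟨m, hm, z, hz, hzi⟩ := exists_reachIn_onGrid ho (by simpa using hN) hx hidx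
    obtain ⟨y, hy, hzy⟩ := hz.simulate
      (R' := fun a b => b ∈ succs (D * 2 ^ N) (D * 2 ^ N * M) P.code a) (V := Codes (D * 2 ^ N))
      (fun x y x' h hs => succs_complete ho h hs.1 hs.2) (codes_start _ q)
    exact ⟨y, ⟨m, hm, _, (hstart _).2 ⟨q, hq, rfl⟩, hy⟩, hzy.idx.trans hzi⟩

/-! ### Bounds in terms of the code of an instance -/

/-- The pairing function dominates its components, so the code of an instance bounds every number
written in it. -/
theorem encode_le_encode_of_mem {X : Type*} [Encodable X] {a : X} {L : List X} (h : a ∈ L) :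
    Encodable.encode a ≤ Encodable.encode L := by
  induction L with
  | nil => simp at h
  | cons b L ih =>
    rw [Encodable.encode_list_cons]
    rcases List.mem_cons.1 h with rfl | h
    · exact (Nat.left_le_pair _ _).trans (Nat.le_succ _)
    · exact ((ih h).trans (Nat.right_le_pair _ _)).trans (Nat.le_succ _)

theorem encode_fst_le {X Y : Type*} [Encodable X] [Encodable Y] (p : X × Y) :
    Encodable.encode p.1 ≤ Encodable.encode p := Nat.left_le_pair _ _

theorem encode_snd_le {X Y : Type*} [Encodable X] [Encodable Y] (p : X × Y) :
    Encodable.encode p.2 ≤ Encodable.encode p := Nat.right_le_pair _ _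

/-- Every denominator is positive and at most the code, hence divides its factorial; a right
endpoint is at most its numerator. -/
theorem Instance.bounded (P : Instance) : P.obs.Bounded (Encodable.encode P.code).factorial
    (Encodable.encode P.code + 1) (Encodable.encode P.code) := by
  have hitem : ∀ it ∈ P.obs, Encodable.encode it.code ≤ Encodable.encode P.code := fun it hit =>
    ((encode_le_encode_of_mem (L := P.code.2.2) (List.mem_map.2 ⟨it, hit, rfl⟩)).trans
      (encode_snd_le P.code.2)).trans (encode_snd_le P.code)
  have hint : ∀ it ∈ P.obs, Encodable.encode it.interval.code ≤ Encodable.encode P.code :=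
    fun it hit => ((encode_fst_le it.code.2).trans (encode_snd_le it.code)).trans (hitem it hit)
  have hlo : ∀ it ∈ P.obs, it.interval.lo.den ≤ Encodable.encode P.code := fun it hit =>
    ((encode_snd_le it.interval.code.1).trans (encode_fst_le it.interval.code)).trans (hint it hit)
  have hhi' : ∀ it ∈ P.obs, Encodable.encode it.interval.code.2.1 ≤ Encodable.encode P.code :=
    fun it hit => ((encode_fst_le it.interval.code.2).trans (encode_snd_le it.interval.code)).trans
      (hint it hit)
  have hhi : ∀ it ∈ P.obs, it.interval.hi.den ≤ Encodable.encode P.code := fun it hit =>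
    (encode_snd_le it.interval.code.2.1).trans (hhi' it hit)
  have hnum : ∀ it ∈ P.obs, it.interval.hi.num ≤ Encodable.encode P.code := fun it hit =>
    (encode_fst_le it.interval.code.2.1).trans (hhi' it hit)
  refine ⟨Nat.factorial_pos _, fun it hit => Nat.dvd_factorial it.interval.lo.den_pos (hlo it hit),
    fun it hit => Nat.dvd_factorial it.interval.hi.den_pos (hhi it hit), fun it hit => ?_,
    fun it hit => ?_⟩
  · have h1 : it.mult.bound = it.mult.code.2 := by cases it.mult <;> rfl
    rw [Nat.lt_succ_iff, h1]
    exact (((encode_snd_le it.code.2.2).trans (encode_snd_le it.code.2)).trans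
      (encode_snd_le it.code)).trans (hitem it hit)
  · refine le_trans ?_ (Nat.cast_le.2 (hnum it hit))
    conv_lhs => rw [← NNRat.num_div_den it.interval.hi]
    exact div_le_self zero_le (by exact_mod_cast it.interval.hi.den_pos)

theorem decideNonempty_iff (P : Instance) :
    decideNonempty P.code = true ↔ (P.aut.consistentWords P.obs).Nonempty := by
  refine search_iff P.bounded ?_
  have h1 : P.numLocs ≤ Encodable.encode P.code :=
    ((encode_fst_le P.code.1.2).trans (encode_snd_le P.code.1)).trans (encode_fst_le P.code)
  have h2 : P.numClocks ≤ Encodable.encode P.code :=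
    ((encode_snd_le P.code.1.2).trans (encode_snd_le P.code.1)).trans (encode_fst_le P.code)
  have h3 : P.obs.length ≤ Encodable.encode P.code := by
    have : P.code.2.2.length = P.obs.length := List.length_map ..
    rw [← this]
    exact ((Encodable.length_le_encode _).trans (encode_snd_le P.code.2)).trans
      (encode_snd_le P.code)
  unfold stepBound
  -- Monotonicity of powers in the exponent requires bases of at least 1, which the `+ 1` in the
  -- innermost base provides.
  gcongr <;> first | omega | exact Nat.one_le_pow _ _ (by omega)

end TimedMon

theorem mainTheorem3 :
    ∃ f : TimedMon.InstanceCode → Bool, Computable f ∧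
      ∀ P : TimedMon.Instance,
        f P.code = true ↔ (P.aut.consistentWords P.obs).Nonempty :=
  ⟨TimedMon.decideNonempty, TimedMon.primrec_decideNonempty.to_comp, TimedMon.decideNonempty_iff⟩
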